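/- Let $L_{pdg}=\{+,-,0,<,\chi,c\}$ with $\chi$ a unary function symbol and $c$ a constant symbol. A precontraction group is a totally ordered abelian group $\Gamma$ with a map $\chi:\Gamma\to\Gamma$ such that for all $a,b\in\Gamma$: $\chi(a)=0\Leftrightarrow a=0$; $a\le b\Rightarrow\chi(a)\le\chi(b)$; $\chi(-a)=-\chi(a)$; and $\chi(a)=\chi(b)$ whenever $a,b$ are archimedean equivalent and have the same sign. It is centripetal if $|\chi(a)|<|a|$ for all $a\neq0$. Let $T_{pdg}$ be the first-order $L_{pdg}$-theory whose models are the nontrivial divisible centripetal precontraction groups $(\Gamma,\chi,c)$ such that $c$ is the least element of $\chi(\Gamma^{<0})$; $\chi:\chi(\Gamma^{<0})\to\chi(\Gamma^{<0})^{>c}$ is a bijection; and for all $a,b\in\chi(\Gamma^{<0})$, $a<b$ implies $a<\chi(a)\le b$. Let $\bigoplus_{i\ge1}\mathbb{Q}e_i$ be ordered lexicographically ($\sum a_ie_i>0$ iff $a_k>0$ for the least $k$ with $a_k\ne0$), with $\chi_{\mathbb{Q}}(0)=0$, $\chi_{\mathbb{Q}}(\sum a_ie_i)=\operatorname{sign}(a_k)e_{k+1}$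 for $k$ the least index with $a_k\neq0$, and $c=-e_2$. Let $\mathbb{T}_{\log}=\bigcup_n\mathbb{R}[[\mathfrak{L}_n]]$ be the field of logarithmic transseries, where $\mathfrak{L}_n$ is the group of monomials $\ell_0^{r_0}\cdots\ell_n^{r_n}$ ($r_i\in\mathbb{R}$) with $\ell_0^{r_0}\cdots\ell_n^{r_n}>1$ iff the first nonzero $r_i$ exists and is positive. Let $\Gamma_{\log}=\bigoplus_{n\ge1}\mathbb{R}\ell_n$ be its lexicographically ordered value group, with valuation $v(\ell_0^{r_0}\cdots\ell_n^{r_n})=-r_0\ell_1-\cdots-r_n\ell_{n+1}$ on monomials and $v(f)=v(\mathfrak{d}(f))$ for $f\neq0$ with dominant monomial $\mathfrak{d}(f)$. For $f=\mathfrak{m}\,r\,(1+\varepsilon)$ with $\mathfrak{m}=\ell_0^{r_0}\cdots\ell_n^{r_n}$, $r\in\mathbb{R}^{>0}$ and $v(\varepsilon)>0$, let $\log f=r_0\ell_1+\cdots+r_n\ell_{n+1}+\log r+\sum_{i>0}(-1)^{i+1}\varepsilon^i/i$. Let $\chi:\Gamma_{\log}\to\Gamma_{\log}$ be given by $\chi(v(f))=v(\log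 f)$ for $f>0$ with $v(f)<0$, $\chi(0)=0$ and $\chi(-\alpha)=-\chi(\alpha)$; and let $c=-\ell_2$. Then: 1. $(\bigoplus_i\mathbb{Q}e_i,\chi_{\mathbb{Q}})$ is a model of $T_{pdg}$ that embeds, as an $L_{pdg}$-structure, into every model of $T_{pdg}$; moreover it is a prime model of $T_{pdg}$, that is, it embeds elementarily into every model of $T_{pdg}$. 2. $T_{pdg}$ is model complete (every embedding between models of $T_{pdg}$ is elementary) and complete (it is satisfiable, and for every $L_{pdg}$-sentence $\varphi$ it entails $\varphi$ or $\neg\varphi$). 3. $(\Gamma_{\log},\chi)$ is a model of $T_{pdg}$, and an $L_{pdg}$-sentence holds in $(\Gamma_{\log},\chi)$ if and only if it is a logical consequence of $T_{pdg}$; that is, $T_{pdg}$ axiomatizes the complete theory of $(\Gamma_{\log},\chi)$. -/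

import Mathlib

open FirstOrder

universe u

/-! # Precontraction groups -/

namespace Pdg

section Groups

variable {Γ : Type*} [AddCommGroup Γ] [LinearOrder Γ] [IsOrderedAddMonoid Γ]

/-- `(Γ, χ)` is a precontraction group. In `arch`, the classes are the archimedean classes
of the ordered abelian group `Γ`. -/
structure IsPrecontraction (χ : Γ → Γ) : Prop where
  eq_zero_iff : ∀ a, χ a = 0 ↔ a = 0
  monotone : ∀ a b, a ≤ b → χ a ≤ χ b
  map_neg : ∀ a, χ (-a) = -χ a
  arch : ∀ a b, ArchimedeanClass.mk a = ArchimedeanClass.mk b →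
    SignType.sign a = SignType.sign b → χ a = χ b

/-- A precontraction group `(Γ, χ)` is centripetal if `|a| > |χ a|` for all `a ≠ 0`. -/
structure IsCentripetal (χ : Γ → Γ) : Prop extends IsPrecontraction χ where
  abs_lt : ∀ a, a ≠ 0 → |χ a| < |a|

/-- `(Γ, χ, c)` is a nontrivial divisible centripetal precontraction group such that `c` is the
least element of `χ(Γ^{<0})`, the map `χ : χ(Γ^{<0}) → χ(Γ^{<0})^{>c}` is a bijection, and
`a < b` implies `a < χ a ≤ b` for `a, b ∈ χ(Γ^{<0})`. -/
structure IsPdg (χ : Γ → Γ) (c : Γ) : Prop extends IsCentripetal χ where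
  nontrivial : ∃ a : Γ, a ≠ 0
  isLeast : IsLeast (χ '' Set.Iio 0) c
  bijOn : Set.BijOn χ (χ '' Set.Iio 0) (χ '' Set.Iio 0 ∩ Set.Ioi c)
  succ : ∀ a ∈ χ '' Set.Iio 0, ∀ b ∈ χ '' Set.Iio 0, a < b → a < χ a ∧ χ a ≤ b
  divisible : ∀ n : ℕ, n ≠ 0 → ∀ a : Γ, ∃ b : Γ, n • b = a

end Groups

/-! # The language and the theory -/

/-- The function symbols `0`, `c`, `-`, `χ`, `+`. -/
inductive Func : ℕ → Type
  | zero : Func 0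
  | c : Func 0
  | neg : Func 1
  | chi : Func 1
  | add : Func 2

/-- The relation symbol `<`. -/
inductive Rel : ℕ → Type
  | lt : Rel 2

/-- The language `{+, -, 0, <, χ, c}`. -/
def L : FirstOrder.Language.{0, 0} := ⟨Func, Rel⟩

/-- The structure on an ordered abelian group given by a map `χ` and an element `c`. -/
@[reducible]
def struct {Γ : Type*} [AddCommGroup Γ] [LT Γ] (χ : Γ → Γ) (c : Γ) : L.Structure Γ where
  funMap := fun f v => match f with
    | .zero => 0
    | .c => c
    | .neg => -v 0
    | .chi => χ (v 0)
    | .add => v 0 + v 1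
  RelMap := fun r v => match r with
    | .lt => v 0 < v 1

section Terms

variable {α : Type*}

def tZero : L.Term α := FirstOrder.Language.Constants.term (L := L) Func.zero

def tC : L.Term α := FirstOrder.Language.Constants.term (L := L) Func.c

def tNeg (t : L.Term α) : L.Term α := FirstOrder.Language.Functions.apply₁ (L := L) Func.neg t

def tChi (t : L.Term α) : L.Term α := FirstOrder.Language.Functions.apply₁ (L := L) Func.chi t

def tAdd (s t : L.Term α) : L.Term α := FirstOrder.Language.Functions.apply₂ (L := L) Func.add s t

/-- The term `n t = t + ⋯ + t`. -/
def tMul : ℕ → L.Term α → L.Term α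
  | 0, _ => tZero
  | n + 1, t => tAdd (tMul n t) t

/-- The formula `s < t`. -/
def fLt {n : ℕ} (s t : L.Term (α ⊕ Fin n)) : L.BoundedFormula α n :=
  FirstOrder.Language.Relations.boundedFormula₂ (L := L) Rel.lt s t

/-- The formula `s ≤ t`, written as `¬ t < s`. -/
def fLe {n : ℕ} (s t : L.Term (α ⊕ Fin n)) : L.BoundedFormula α n := ∼(fLt t s)

/-- The formula `t < 0`. -/
def fNeg {n : ℕ} (t : L.Term (α ⊕ Fin n)) : L.BoundedFormula α n := fLt t tZero

/-- The formula `0 < t`. -/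
def fPos {n : ℕ} (t : L.Term (α ⊕ Fin n)) : L.BoundedFormula α n := fLt tZero t

end Terms

open FirstOrder.Language in
/-- The axioms of nontrivial ordered abelian groups. -/
def axGroup : L.Theory :=
  { ∀' ∀' ∀' (tAdd (tAdd &0 &1) &2 =' tAdd &0 (tAdd &1 &2)),
    ∀' ∀' (tAdd &0 &1 =' tAdd &1 &0),
    ∀' (tAdd tZero &0 =' &0),
    ∀' (tAdd (tNeg &0) &0 =' tZero),
    ∀' ∼(fLt &0 &0),
    ∀' ∀' ∀' (fLt &0 &1 ⟹ fLt &1 &2 ⟹ fLt &0 &2),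
    ∀' ∀' (fLt &0 &1 ⊔ (&0 =' &1 ⊔ fLt &1 &0)),
    ∀' ∀' ∀' (fLt &0 &1 ⟹ fLt (tAdd &0 &2) (tAdd &1 &2)),
    ∃' ∼(&0 =' tZero) }

open FirstOrder.Language in
/-- The axioms of centripetal precontractions, except for the one on archimedean classes. -/
def axContraction : L.Theory :=
  { ∀' ((tChi &0 =' tZero) ⇔ (&0 =' tZero)),
    ∀' ∀' (fLe &0 &1 ⟹ fLe (tChi &0) (tChi &1)),
    ∀' (tChi (tNeg &0) =' tNeg (tChi &0)),
    ∀' (fPos &0 ⟹ (fLt (tChi &0) &0 ⊓ fLt (tNeg &0) (tChi &0))),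
    ∀' (fNeg &0 ⟹ (fLt &0 (tChi &0) ⊓ fLt (tChi &0) (tNeg &0))) }

open FirstOrder.Language in
/-- If `0 < a, b`, `a ≤ n b` and `b ≤ n a`, then `χ a = χ b`. -/
def axArchPos (n : ℕ) : L.Sentence :=
  ∀' ∀' (fPos &0 ⟹ fPos &1 ⟹ fLe &0 (tMul n &1) ⟹ fLe &1 (tMul n &0) ⟹
    (tChi &0 =' tChi &1))

open FirstOrder.Language in
/-- If `a, b < 0`, `n b ≤ a` and `n a ≤ b`, then `χ a = χ b`. -/
def axArchNeg (n : ℕ) : L.Sentence :=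
  ∀' ∀' (fNeg &0 ⟹ fNeg &1 ⟹ fLe (tMul n &1) &0 ⟹ fLe (tMul n &0) &1 ⟹
    (tChi &0 =' tChi &1))

open FirstOrder.Language in
/-- Every element is divisible by `n + 1`. -/
def axDiv (n : ℕ) : L.Sentence := ∀' ∃' (tMul (n + 1) &1 =' &0)

open FirstOrder.Language in
/-- The axioms on `χ(Γ^{<0})`: `c` is its least element (first two), `χ` maps it bijectively onto
its elements greater than `c` (next three), and `χ` is its successor function (last one). -/
def axDiscrete : L.Theory :=
  { ∃' (fNeg &0 ⊓ (tChi &0 =' tC)),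
    ∀' (fNeg &0 ⟹ fLe tC (tChi &0)),
    ∀' (fNeg &0 ⟹ ((∃' (fNeg &1 ⊓ (tChi &1 =' tChi (tChi &0)))) ⊓ fLt tC (tChi (tChi &0)))),
    ∀' ∀' (fNeg &0 ⟹ fNeg &1 ⟹ (tChi (tChi &0) =' tChi (tChi &1)) ⟹ (tChi &0 =' tChi &1)),
    ∀' (fNeg &0 ⟹ fLt tC (tChi &0) ⟹ ∃' (fNeg &1 ⊓ (tChi (tChi &1) =' tChi &0))),
    ∀' ∀' (fNeg &0 ⟹ fNeg &1 ⟹ fLt (tChi &0) (tChi &1) ⟹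
      (fLt (tChi &0) (tChi (tChi &0)) ⊓ fLe (tChi (tChi &0)) (tChi &1))) }

/-- The theory of centripetal precontraction discrete groups. -/
def T : L.Theory :=
  axGroup ∪ axContraction ∪ Set.range axArchPos ∪ Set.range axArchNeg ∪ Set.range axDiv ∪
    axDiscrete

section Check

variable {M : Type*} [L.Structure M]

open FirstOrder.Language

/-- The operations of an `L`-structure. -/
def oZero (M : Type*) [L.Structure M] : M := Structure.funMap (L := L) Func.zero ![]
def oC (M : Type*) [L.Structure M] : M := Structure.funMap (L := L) Func.c ![]
def oNeg (a : M) : M := Structure.funMap (L := L) Func.neg ![a]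
def oChi (a : M) : M := Structure.funMap (L := L) Func.chi ![a]
def oAdd (a b : M) : M := Structure.funMap (L := L) Func.add ![a, b]
def oLt (a b : M) : Prop := Structure.RelMap (L := L) Rel.lt ![a, b]
def oMul : ℕ → M → M
  | 0, _ => oZero M
  | n + 1, t => oAdd (oMul n t) t

variable {α : Type*} (v : α → M)

theorem realize_tZero : (tZero : L.Term α).realize v = oZero M := by
  exact (Term.realize_func v _ _).trans (congrArg _ (Subsingleton.elim _ _))

theorem realize_tC : (tC : L.Term α).realize v = oC M := by
  exact (Term.realize_func v _ _).trans (congrArg _ (Subsingleton.elim _ _))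

theorem realize_tNeg (t : L.Term α) : (tNeg t).realize v = oNeg (t.realize v) :=
  Term.realize_functions_apply₁

theorem realize_tChi (t : L.Term α) : (tChi t).realize v = oChi (t.realize v) :=
  Term.realize_functions_apply₁

theorem realize_tAdd (s t : L.Term α) :
    (tAdd s t).realize v = oAdd (s.realize v) (t.realize v) :=
  Term.realize_functions_apply₂

theorem realize_tMul (n : ℕ) (t : L.Term α) : (tMul n t).realize v = oMul n (t.realize v) := by
  induction n with
  | zero => exact realize_tZero v
  | succ n ih => rw [tMul, realize_tAdd, ih, oMul]

theorem realize_fLt {n : ℕ} (xs : Fin n → M) (s t : L.Term (α ⊕ Fin n)) :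
    (fLt s t).Realize v xs ↔ oLt (s.realize (Sum.elim v xs)) (t.realize (Sum.elim v xs)) :=
  BoundedFormula.realize_rel₂

/-- The meaning of the axioms in an arbitrary structure. -/
theorem model_iff_aux : M ⊨ T ↔
    ((∀ a b c : M, oAdd (oAdd a b) c = oAdd a (oAdd b c)) ∧
      (∀ a b : M, oAdd a b = oAdd b a) ∧ (∀ a : M, oAdd (oZero M) a = a) ∧
      (∀ a : M, oAdd (oNeg a) a = oZero M) ∧ (∀ a : M, ¬ oLt a a) ∧
      (∀ a b c : M, oLt a b → oLt b c → oLt a c) ∧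
      (∀ a b : M, oLt a b ∨ a = b ∨ oLt b a) ∧
      (∀ a b c : M, oLt a b → oLt (oAdd a c) (oAdd b c)) ∧ (∃ a : M, ¬ a = oZero M)) ∧
    ((∀ a : M, oChi a = oZero M ↔ a = oZero M) ∧
      (∀ a b : M, ¬ oLt b a → ¬ oLt (oChi b) (oChi a)) ∧
      (∀ a : M, oChi (oNeg a) = oNeg (oChi a)) ∧
      (∀ a : M, oLt (oZero M) a → oLt (oChi a) a ∧ oLt (oNeg a) (oChi a)) ∧
      (∀ a : M, oLt a (oZero M) → oLt a (oChi a) ∧ oLt (oChi a) (oNeg a))) ∧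
    (∀ n : ℕ, ∀ a b : M, oLt (oZero M) a → oLt (oZero M) b → ¬ oLt (oMul n b) a →
      ¬ oLt (oMul n a) b → oChi a = oChi b) ∧
    (∀ n : ℕ, ∀ a b : M, oLt a (oZero M) → oLt b (oZero M) → ¬ oLt a (oMul n b) →
      ¬ oLt b (oMul n a) → oChi a = oChi b) ∧
    (∀ n : ℕ, ∀ a : M, ∃ b : M, oMul (n + 1) b = a) ∧
    ((∃ a : M, oLt a (oZero M) ∧ oChi a = oC M) ∧
      (∀ a : M, oLt a (oZero M) → ¬ oLt (oChi a) (oC M)) ∧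
      (∀ a : M, oLt a (oZero M) → (∃ b : M, oLt b (oZero M) ∧ oChi b = oChi (oChi a)) ∧
        oLt (oC M) (oChi (oChi a))) ∧
      (∀ a b : M, oLt a (oZero M) → oLt b (oZero M) → oChi (oChi a) = oChi (oChi b) →
        oChi a = oChi b) ∧
      (∀ a : M, oLt a (oZero M) → oLt (oC M) (oChi a) →
        ∃ b : M, oLt b (oZero M) ∧ oChi (oChi b) = oChi a) ∧
      (∀ a b : M, oLt a (oZero M) → oLt b (oZero M) → oLt (oChi a) (oChi b) →
        oLt (oChi a) (oChi (oChi a)) ∧ ¬ oLt (oChi b) (oChi (oChi a)))) := by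
  simp only [T, Theory.model_union_iff, and_assoc]
  simp only [Theory.model_iff, Set.mem_range,
    forall_exists_index, forall_apply_eq_imp_iff, axGroup, axContraction, axDiscrete, axDiv,
    axArchPos, axArchNeg, Set.mem_insert_iff, Set.mem_singleton_iff, forall_eq_or_imp, forall_eq,
    Sentence.Realize, Formula.Realize, BoundedFormula.realize_all, BoundedFormula.realize_ex,
    BoundedFormula.realize_imp, BoundedFormula.realize_inf, BoundedFormula.realize_sup,
    BoundedFormula.realize_not, BoundedFormula.realize_iff, BoundedFormula.realize_bdEqual,
    fLe, fPos, fNeg, realize_fLt, realize_tZero, realize_tC, realize_tNeg, realize_tChi,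
    realize_tAdd, realize_tMul]
  simp only [and_assoc]
  rfl

end Check

section Models

theorem oMul_struct {Γ : Type*} [AddCommGroup Γ] [LT Γ] (χ : Γ → Γ) (c : Γ) (n : ℕ) (a : Γ) :
    @oMul Γ (struct χ c) n a = n • a := by
  let _ := struct χ c
  induction n with
  | zero => exact (zero_nsmul a).symm
  | succ n ih => rw [succ_nsmul, ← ih]; rfl

variable {Γ : Type*} [AddCommGroup Γ] [LinearOrder Γ] [IsOrderedAddMonoid Γ]

/-- An ordered abelian group with a map `χ` and an element `c` is a model of the theory iff it
satisfies the mathematical definition. -/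
theorem model_struct_iff (χ : Γ → Γ) (c : Γ) :
    @FirstOrder.Language.Theory.Model L Γ (struct χ c) T ↔ IsPdg χ c := by
  let _ := struct χ c
  have h0 : oZero Γ = 0 := rfl
  have hc : oC Γ = c := rfl
  have hneg : ∀ a : Γ, oNeg a = -a := fun _ => rfl
  have hchi : ∀ a : Γ, oChi a = χ a := fun _ => rfl
  have hadd : ∀ a b : Γ, oAdd a b = a + b := fun _ _ => rfl
  have hlt : ∀ a b : Γ, oLt a b ↔ a < b := fun _ _ => Iff.rfl
  have hmul : ∀ (n : ℕ) (a : Γ), oMul n a = n • a := oMul_struct χ c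
  rw [model_iff_aux]
  simp only [h0, hc, hneg, hchi, hadd, hlt, hmul, not_lt]
  constructor
  · rintro ⟨⟨-, -, -, -, -, -, -, -, hnt⟩, ⟨hz, hm, hn, hcp, hcn⟩, hap, han, hd,
      ⟨d1, d2, d3, d4, d5, d6⟩⟩
    refine ⟨⟨⟨hz, hm, hn, ?_⟩, ?_⟩, hnt, ⟨?_, ?_⟩, ⟨?_, ?_, ?_⟩, ?_, ?_⟩
    · intro a b hab hs
      rw [ArchimedeanClass.mk_eq_mk] at hab
      obtain ⟨⟨m, hm'⟩, n, hn'⟩ := hab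
      have hm2 : |b| ≤ (m + n) • |a| :=
        hm'.trans (nsmul_le_nsmul_left (abs_nonneg a) (Nat.le_add_right m n))
      have hn2 : |a| ≤ (m + n) • |b| :=
        hn'.trans (nsmul_le_nsmul_left (abs_nonneg b) (Nat.le_add_left n m))
      rcases lt_trichotomy a 0 with ha | rfl | ha
      · have hb : b < 0 := by
          rw [sign_neg ha] at hs
          exact sign_eq_neg_one_iff.1 hs.symm
        rw [abs_of_neg ha, abs_of_neg hb, smul_neg, neg_le_neg_iff] at hm2 hn2
        exact han _ a b ha hb hn2 hm2
      · rw [sign_zero] at hs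
        rw [sign_eq_zero_iff.1 hs.symm]
      · have hb : 0 < b := by
          rw [sign_pos ha] at hs
          exact sign_eq_one_iff.1 hs.symm
        rw [abs_of_pos ha, abs_of_pos hb] at hm2 hn2
        exact hap _ a b ha hb hn2 hm2
    · intro a ha
      rcases lt_or_gt_of_ne ha with h | h
      · rw [abs_of_neg h, abs_lt]
        exact ⟨by simpa using (hcn a h).1, (hcn a h).2⟩
      · rw [abs_of_pos h, abs_lt]
        exact ⟨(hcp a h).2, (hcp a h).1⟩
    · obtain ⟨a, ha, rfl⟩ := d1
      exact ⟨a, ha, rfl⟩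
    · rintro _ ⟨a, ha, rfl⟩
      exact d2 a ha
    · rintro _ ⟨a, ha, rfl⟩
      obtain ⟨⟨b, hb, hb'⟩, h⟩ := d3 a ha
      exact ⟨⟨b, hb, hb'⟩, h⟩
    · rintro _ ⟨a, ha, rfl⟩ _ ⟨b, hb, rfl⟩ h
      exact d4 a b ha hb h
    · rintro _ ⟨⟨a, ha, rfl⟩, h⟩
      obtain ⟨b, hb, hb'⟩ := d5 a ha h
      exact ⟨χ b, ⟨b, hb, rfl⟩, hb'⟩
    · rintro _ ⟨a, ha, rfl⟩ _ ⟨b, hb, rfl⟩ h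
      exact d6 a b ha hb h
    · intro n hn0 a
      obtain ⟨k, rfl⟩ := Nat.exists_eq_succ_of_ne_zero hn0
      exact hd k a
  · intro h
    refine ⟨⟨add_assoc, add_comm, zero_add, neg_add_cancel, le_refl, fun _ _ _ => lt_trans,
      lt_trichotomy, fun a b c hab => add_lt_add_left hab c, h.nontrivial⟩,
      ⟨h.eq_zero_iff, h.monotone, h.map_neg, ?_, ?_⟩, ?_, ?_, ?_, ?_, ?_, ?_, ?_, ?_, ?_⟩
    · intro a ha
      have := h.abs_lt a ha.ne'
      rw [abs_of_pos ha, abs_lt] at this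
      exact ⟨this.2, this.1⟩
    · intro a ha
      have := h.abs_lt a ha.ne
      rw [abs_of_neg ha, abs_lt, neg_neg] at this
      exact this
    · intro n a b ha hb hab hba
      refine h.arch a b (ArchimedeanClass.mk_eq_mk.2 ⟨⟨n, ?_⟩, n, ?_⟩)
        (by rw [sign_pos ha, sign_pos hb])
      · rwa [abs_of_pos ha, abs_of_pos hb]
      · rwa [abs_of_pos ha, abs_of_pos hb]
    · intro n a b ha hb hab hba
      refine h.arch a b (ArchimedeanClass.mk_eq_mk.2 ⟨⟨n, ?_⟩, n, ?_⟩)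
        (by rw [sign_neg ha, sign_neg hb])
      · rwa [abs_of_neg ha, abs_of_neg hb, smul_neg, neg_le_neg_iff]
      · rwa [abs_of_neg ha, abs_of_neg hb, smul_neg, neg_le_neg_iff]
    · exact fun n a => h.divisible (n + 1) n.succ_ne_zero a
    · exact h.isLeast.1
    · exact fun a ha => h.isLeast.2 ⟨a, ha, rfl⟩
    · exact fun a ha => h.bijOn.mapsTo ⟨a, ha, rfl⟩
    · exact fun a b ha hb hab => h.bijOn.injOn ⟨a, ha, rfl⟩ ⟨b, hb, rfl⟩ hab
    · intro a ha hca
      obtain ⟨_, ⟨b, hb, rfl⟩, h'⟩ := h.bijOn.surjOn ⟨⟨a, ha, rfl⟩, hca⟩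
      exact ⟨b, hb, h'⟩
    · exact fun a b ha hb hab => h.succ _ ⟨a, ha, rfl⟩ _ ⟨b, hb, rfl⟩ hab

/-- Every model of the theory is an ordered abelian group with a map `χ` and an element `c`. -/
theorem exists_eq_struct (M : Type*) [S : L.Structure M] (h : M ⊨ T) :
    ∃ (_ : AddCommGroup M) (_ : LinearOrder M) (_ : IsOrderedAddMonoid M) (χ : M → M) (c : M),
      S = struct χ c := by
  classical
  obtain ⟨⟨h1, h2, h3, h4, h5, h6, h7, h8, -⟩, -⟩ := model_iff_aux.1 h
  let _ : Zero M := ⟨oZero M⟩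
  let _ : Add M := ⟨oAdd⟩
  let _ : Neg M := ⟨oNeg⟩
  let gr : AddCommGroup M :=
    { add_assoc := h1
      add_comm := h2
      zero_add := h3
      add_zero := fun a => (h2 a _).trans (h3 a)
      neg_add_cancel := h4
      nsmul := nsmulRec
      zsmul := zsmulRec }
  let lo : LinearOrder M :=
    { le := fun a b => oLt a b ∨ a = b
      lt := oLt
      le_refl := fun a => Or.inr rfl
      le_trans := by
        rintro a b c (hab | rfl) (hbc | rfl)
        · exact Or.inl (h6 _ _ _ hab hbc)
        · exact Or.inl hab
        · exact Or.inl hbc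
        · exact Or.inr rfl
      lt_iff_le_not_ge := by
        intro a b
        constructor
        · intro hab
          refine ⟨Or.inl hab, ?_⟩
          rintro (hba | rfl)
          · exact h5 _ (h6 _ _ _ hab hba)
          · exact h5 _ hab
        · rintro ⟨hab | rfl, hba⟩
          · exact hab
          · exact absurd (Or.inr rfl) hba
      le_antisymm := by
        rintro a b (hab | rfl) (hba | hba)
        · exact absurd (h6 _ _ _ hab hba) (h5 _)
        · exact hba.symm
        · rfl
        · rfl
      le_total := by
        intro a b
        rcases h7 a b with h | h | h
        · exact Or.inl (Or.inl h)
        · exact Or.inl (Or.inr h)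
        · exact Or.inr (Or.inl h)
      toDecidableLE := Classical.decRel _ }
  have io : IsOrderedAddMonoid M :=
    { add_le_add_left := by
        rintro a b (hab | rfl) c
        · exact Or.inl (h8 a b c hab)
        · exact Or.inr rfl }
  refine ⟨gr, lo, io, oChi, oC M, ?_⟩
  ext n f v
  · cases f with
    | zero => exact congrArg _ (Subsingleton.elim _ _)
    | c => exact congrArg _ (Subsingleton.elim _ _)
    | neg => exact congrArg _ (funext fun i => by fin_cases i; rfl)
    | chi => exact congrArg _ (funext fun i => by fin_cases i; rfl)
    | add => exact congrArg _ (funext fun i => by fin_cases i <;> rfl)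
  · cases f with
    | lt => exact iff_of_eq (congrArg _ (funext fun i => by fin_cases i <;> rfl))

end Models

noncomputable section

/-! # The model `(⨁ ℚ eᵢ, χ_ℚ)` -/

/-- The lexicographically ordered group `⨁_{i ≥ 1} ℚ eᵢ`; the index `k : ℕ` stands for
`e_{k+1}`. -/
abbrev QSum : Type := Lex (ℕ →₀ ℚ)

open scoped Classical in
/-- `χ_ℚ(∑ aᵢ eᵢ) = sign(a_k) e_{k+1}`, where `k` is the least index with `a_k ≠ 0`. -/
def chiQ (a : QSum) : QSum :=
  if h : (ofLex a).support.Nonempty then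
    toLex (Finsupp.single ((ofLex a).support.min' h + 1)
      ((SignType.sign (ofLex a ((ofLex a).support.min' h)) : SignType) : ℚ))
  else 0

/-- The constant `c = -e₂` of `⨁ ℚ eᵢ`. -/
def cQ : QSum := toLex (Finsupp.single 1 (-1))

/-! # Logarithmic transseries and their value group -/

/-- The lexicographically ordered real vector space `Γ_log = ⨁_{n ≥ 1} ℝ ℓₙ`; the index `k : ℕ`
stands for `ℓ_{k+1}`. -/
abbrev GammaLog : Type := Lex (ℕ →₀ ℝ)

/-- The Hahn field of well-based series over the group of all monomials `ℓ₀^{r₀} ⋯ ℓₙ^{rₙ}`.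
Such a monomial is written as `single γ 1`, where `γ = -r₀ ℓ₁ - ⋯ - rₙ ℓ_{n+1}` is its valuation.
This reverses the order, so supports are well-ordered subsets of `Γ_log`. -/
abbrev Hahn : Type := HahnSeries GammaLog ℝ

/-- The monomial `∏ ℓᵢ^{rᵢ}`. -/
def monomial (r : ℕ →₀ ℝ) : Hahn := HahnSeries.single (-toLex r) 1

/-- The valuations of the monomials in `ℓ₀, …, ℓₙ`. -/
def valuesLE (n : ℕ) : AddSubgroup GammaLog where
  carrier := {γ | ∀ i, n < i → ofLex γ i = 0}
  zero_mem' := fun _ _ => rfl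
  add_mem' := fun {a b} ha hb i hi => by
    rw [ofLex_add, Finsupp.add_apply, ha i hi, hb i hi, add_zero]
  neg_mem' := fun {a} ha i hi => by
    rw [ofLex_neg, Finsupp.neg_apply, ha i hi, neg_zero]

/-- The inclusion into the big Hahn field of the Hahn field over the monomials in
`ℓ₀, …, ℓₙ`. -/
def hahnIncl (n : ℕ) : HahnSeries (valuesLE n) ℝ →+* Hahn :=
  HahnSeries.embDomainRingHom (valuesLE n).subtype Subtype.val_injective fun _ _ => Iff.rfl

/-- The Hahn field over the monomials in `ℓ₀, …, ℓₙ`, as a subfield of the big Hahn field. -/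
def hahnSub (n : ℕ) : Subfield Hahn :=
  RingHom.fieldRange (K := HahnSeries (valuesLE n) ℝ) (hahnIncl n)

/-- The field `𝕋_log` of logarithmic transseries, the union over `n` of the Hahn fields over the
monomials in `ℓ₀, …, ℓₙ`. -/
def TLog : Subfield Hahn := ⨆ n, hahnSub n

theorem mem_hahnSub_iff {n : ℕ} {f : Hahn} :
    f ∈ hahnSub n ↔ ∀ γ, f.coeff γ ≠ 0 → γ ∈ valuesLE n := by
  constructor
  · rintro ⟨g, rfl⟩ γ hγ
    by_contra h
    exact hγ (HahnSeries.embDomain_of_notMem_range (by rintro ⟨x, rfl⟩; exact h x.2))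
  · intro h
    refine ⟨⟨fun γ => f.coeff γ, ?_⟩, ?_⟩
    · exact fun g => f.isPWO_support fun k => ⟨(g k).1.1, (g k).2⟩
    · ext γ
      by_cases hγ : γ ∈ valuesLE n
      · exact HahnSeries.embDomain_coeff (a := (⟨γ, hγ⟩ : valuesLE n))
      · rw [not_imp_comm.1 (h γ) hγ]
        exact HahnSeries.embDomain_of_notMem_range (by rintro ⟨x, rfl⟩; exact hγ x.2)

/-- A series lies in `𝕋_log` iff its support only involves finitely many of the `ℓᵢ`. -/
theorem mem_TLog_iff {f : Hahn} :
    f ∈ TLog ↔ ∃ n, ∀ γ, f.coeff γ ≠ 0 → γ ∈ valuesLE n := by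
  have hdir : Directed (· ≤ ·) fun n => hahnSub n := by
    refine Monotone.directed_le fun m n hmn f hf => ?_
    rw [mem_hahnSub_iff] at hf ⊢
    exact fun γ hγ i hi => hf γ hγ i (lt_of_le_of_lt hmn hi)
  simp only [TLog, Subfield.mem_iSup_of_directed hdir, mem_hahnSub_iff]

theorem single_mem_TLog (γ : GammaLog) (r : ℝ) : HahnSeries.single γ r ∈ TLog := by
  rw [mem_TLog_iff]
  refine ⟨(ofLex γ).support.sup id, fun δ hδ i hi => ?_⟩
  have : δ = γ := by
    by_contra h
    exact hδ (HahnSeries.coeff_single_of_ne h)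
  subst this
  by_contra h
  exact absurd (Finset.le_sup (f := id) (Finsupp.mem_support_iff.2 h)) (not_le.2 hi)

theorem heval_mem_TLog {ε : Hahn} (hε : ε ∈ TLog) (p : PowerSeries ℝ) :
    PowerSeries.heval ε p ∈ TLog := by
  obtain ⟨n, hn⟩ := mem_TLog_iff.1 hε
  rw [mem_TLog_iff]
  refine ⟨n, fun γ hγ => ?_⟩
  by_cases h : 0 < ε.orderTop
  · by_contra hmem
    refine hγ ?_
    rw [PowerSeries.coeff_heval]
    refine finsum_eq_zero_of_forall_eq_zero fun k => ?_
    have hk : ε ^ k ∈ hahnSub n := pow_mem (mem_hahnSub_iff.2 hn) k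
    have h0 : (ε ^ k).coeff γ = 0 := by
      by_contra h'
      exact hmem (mem_hahnSub_iff.1 hk γ h')
    simp [h, h0]
  · rw [PowerSeries.heval_apply, HahnSeries.SummableFamily.powerSeriesFamily_of_not_orderTop_pos h,
      HahnSeries.SummableFamily.powerSeriesFamily_hsum_zero] at hγ
    have : γ = 0 := by
      by_contra h'
      simp [HahnSeries.coeff_one, h'] at hγ
    rw [this]
    exact zero_mem _

/-- The logarithmic section on the monomial with valuation `γ`:
`L(ℓ₀^{r₀} ⋯ ℓₙ^{rₙ}) = r₀ ℓ₁ + ⋯ + rₙ ℓ_{n+1}`. -/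
def logMonomial (γ : GammaLog) : Hahn :=
  (-ofLex γ).sum fun i r => r • monomial (Finsupp.single (i + 1) 1)

theorem logMonomial_mem (γ : GammaLog) : logMonomial γ ∈ TLog := by
  refine sum_mem fun i _ => ?_
  have : ((-ofLex γ) i) • monomial (Finsupp.single (i + 1) 1) =
      HahnSeries.single (-toLex (Finsupp.single (i + 1) 1)) ((-ofLex γ) i * 1) := by
    ext δ
    simp only [monomial, HahnSeries.coeff_smul, HahnSeries.coeff_single, smul_eq_mul, mul_ite,
      mul_zero]
    split_ifs <;> rfl
  change ((-ofLex γ) i) • monomial (Finsupp.single (i + 1) 1) ∈ TLog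
  rw [this]
  exact single_mem_TLog _ _

/-- The power series `log (1 + X) = ∑_{i > 0} (-1)^{i+1} Xⁱ / i`. -/
def logSeries : PowerSeries ℝ := PowerSeries.mk fun i => if i = 0 then 0 else (-1) ^ (i + 1) / i

/-- The series `ε` in `f = 𝔡(f) · f_{𝔡(f)} · (1 + ε)`. -/
def eps (f : Hahn) : Hahn := f * (HahnSeries.single f.order f.leadingCoeff)⁻¹ - 1

theorem eps_orderTop_pos {f : Hahn} (hf : f ≠ 0) : 0 < (eps f).orderTop := by
  have hl : f.leadingCoeff ≠ 0 := HahnSeries.leadingCoeff_ne_zero.2 hf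
  rw [eps, HahnSeries.orderTop_self_sub_one_pos_iff, HahnSeries.inv_single,
    HahnSeries.orderTop_mul, HahnSeries.leadingCoeff_mul, HahnSeries.leadingCoeff_of_single,
    HahnSeries.orderTop_single (inv_ne_zero hl), ← HahnSeries.order_eq_orderTop_of_ne_zero hf,
    ← WithTop.coe_add, add_neg_cancel]
  exact ⟨rfl, mul_inv_cancel₀ hl⟩

/-- The logarithm `log f = L(𝔡(f)) + log f_{𝔡(f)} + ∑_{i > 0} (-1)^{i+1} εⁱ / i` of `f > 0`, where
`f = 𝔡(f) · f_{𝔡(f)} · (1 + ε)`, with dominant monomial `𝔡(f)`. -/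
def log (f : TLog) : TLog :=
  ⟨logMonomial f.1.order + HahnSeries.C (Real.log f.1.leadingCoeff) +
      PowerSeries.heval (eps f.1) logSeries,
    add_mem (add_mem (logMonomial_mem _) (single_mem_TLog _ _)) (heval_mem_TLog
      (sub_mem (mul_mem f.2 (inv_mem (single_mem_TLog _ _))) (one_mem _)) _)⟩

/-- The valuation `v : 𝕋_log → Γ_log ∪ {∞}`. -/
def v (f : TLog) : WithTop GammaLog := f.1.orderTop

/-- `f > 0` in the ordered field `𝕋_log`, that is, the leading coefficient of `f` is positive. -/
def Pos (f : TLog) : Prop := 0 < f.1.leadingCoeff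

/-- The monomial with valuation `γ`, as an element of `𝕋_log`. -/
def monomialOf (γ : GammaLog) : TLog := ⟨HahnSeries.single γ 1, single_mem_TLog _ _⟩

/-- The map `χ'(α) = v(log f)`, for `α < 0` and any `f > 0` with `v f = α`. The definition uses
the monomial with valuation `α`; see `chiNeg_eq` for the independence of `f`. -/
def chiNeg (α : GammaLog) : GammaLog := (log (monomialOf α)).1.order

theorem logMonomial_orderTop_neg {γ : GammaLog} (h : γ ≠ 0) : (logMonomial γ).orderTop < 0 := by
  obtain ⟨k, hk⟩ : ∃ k, ofLex γ k ≠ 0 := by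
    by_contra! h'
    exact h (congrArg toLex (Finsupp.ext h' : ofLex γ = 0))
  have hc : (logMonomial γ).coeff (-toLex (Finsupp.single (k + 1) 1)) = -ofLex γ k := by
    rw [logMonomial, Finsupp.sum, HahnSeries.coeff_sum, Finset.sum_eq_single k]
    · simp [monomial]
    · intro i _ hi
      have hne : (-toLex (Finsupp.single (k + 1) 1) : GammaLog) ≠
          -toLex (Finsupp.single (i + 1) 1) := by
        intro h'
        have h2 := DFunLike.congr_fun (congrArg ofLex (neg_injective h')) (k + 1)
        simp [hi] at h2
      simp [monomial, HahnSeries.coeff_single_of_ne hne]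
    · intro hk'
      simp at hk'
      exact absurd hk' hk
  refine (HahnSeries.orderTop_le_of_coeff_ne_zero (hc.trans_ne (neg_ne_zero.2 hk))).trans_lt ?_
  have : (-toLex (Finsupp.single (k + 1) 1) : GammaLog) < 0 := by
    rw [neg_lt_zero, Finsupp.Lex.lt_iff]
    refine ⟨k + 1, fun j hj => ?_, ?_⟩
    · simp [hj.ne']
    · simp
  exact_mod_cast this

theorem v_log {f : TLog} (hf : Pos f) {α : GammaLog} (hv : v f = α) (hα : α < 0) :
    v (log f) = (logMonomial α).orderTop ∧ (logMonomial α).orderTop < 0 := by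
  have hneg := logMonomial_orderTop_neg hα.ne
  refine ⟨?_, hneg⟩
  have ho : f.1.order = α := by
    have hne : f.1 ≠ 0 := by
      rintro h
      simp [Pos, h] at hf
    have := HahnSeries.order_eq_orderTop_of_ne_zero hne
    exact WithTop.coe_injective (this.trans hv)
  have hC : (0 : WithTop GammaLog) ≤ (HahnSeries.C (Real.log f.1.leadingCoeff) : Hahn).orderTop :=
    HahnSeries.orderTop_single_le
  have hE : (0 : WithTop GammaLog) ≤ (PowerSeries.heval (eps f.1) logSeries).orderTop := by
    by_cases h : 0 < (eps f.1).orderTop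
    · rw [HahnSeries.le_orderTop_iff_forall]
      intro j hj
      rw [PowerSeries.coeff_heval]
      refine finsum_eq_zero_of_forall_eq_zero fun k => ?_
      have hk : (0 : WithTop GammaLog) ≤ (eps f.1 ^ k).orderTop :=
        (nsmul_nonneg h.le k).trans HahnSeries.orderTop_nsmul_le_orderTop_pow
      simp [h, HahnSeries.coeff_eq_zero_of_lt_orderTop (hj.trans_le hk)]
    · rw [PowerSeries.heval_apply,
        HahnSeries.SummableFamily.powerSeriesFamily_of_not_orderTop_pos h,
        HahnSeries.SummableFamily.powerSeriesFamily_hsum_zero]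
      simp [logSeries, ← PowerSeries.coeff_zero_eq_constantCoeff_apply]
  simp only [v, log, ho]
  rw [add_assoc, HahnSeries.orderTop_add_eq_left]
  exact hneg.trans_le ((le_min hC hE).trans HahnSeries.min_orderTop_le_orderTop_add)

/-- `χ'` is well defined. -/
theorem chiNeg_eq {f : TLog} (hf : Pos f) {α : GammaLog} (hv : v f = α) (hα : α < 0) :
    v (log f) = chiNeg α := by
  have h1 := v_log hf hv hα
  have h2 := v_log (f := monomialOf α) (by simp [Pos, monomialOf]) (by simp [v, monomialOf]) hα
  rw [h1.1, ← h2.1, chiNeg, v, HahnSeries.order_eq_orderTop_of_ne_zero]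
  rw [← HahnSeries.orderTop_ne_top]
  exact ne_top_of_lt (h2.1.trans_lt h2.2)

open scoped Classical in
/-- The map `χ : Γ_log → Γ_log` induced by the logarithm. -/
def chiLog (α : GammaLog) : GammaLog :=
  if α < 0 then chiNeg α else if α = 0 then 0 else -chiNeg (-α)

/-- The least element `c = -ℓ₂` of `χ(Γ_log^{<0})`. -/
def cLog : GammaLog := toLex (Finsupp.single 1 (-1))

instance : L.Structure QSum := struct chiQ cQ

instance : L.Structure GammaLog := struct chiLog cLog

end

/-! # Prime models and model completeness -/

section ModelTheory

open FirstOrder.Language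

variable {L' : FirstOrder.Language.{0, 0}}

/-- `M` is a prime model of the theory `S`: it is a model of `S` and embeds elementarily into
every model of `S`. -/
def IsPrimeModel (S : L'.Theory) (M : Type) [L'.Structure M] : Prop :=
  M ⊨ S ∧ ∀ (N : Type u) [L'.Structure N], N ⊨ S → Nonempty (M ↪ₑ[L'] N)

/-- The theory `S` is model complete: every embedding between models of `S` is elementary. -/
def IsModelComplete (S : L'.Theory) : Prop :=
  ∀ (M N : Type u) [L'.Structure M] [L'.Structure N], M ⊨ S → N ⊨ S →
    ∀ (f : M ↪[L'] N) (n : ℕ) (φ : L'.Formula (Fin n)) (x : Fin n → M),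
      φ.Realize (f ∘ x) ↔ φ.Realize x

end ModelTheory

end Pdg

set_option linter.unusedSectionVars false

/-! Everything rests on `realize_iff_of_countable`: a formula with parameters in a countable model
`K` has the same truth value in all models into which `K` embeds. With `K = QSum`, which embeds into
every model, this gives primality and completeness. With `K` a countable elementary substructure of
`M` containing given parameters, it gives model completeness. Since `GammaLog` is a model,
completeness identifies its theory with the consequences of `T`.

In a model, `χ(Γ^{<0})` is a discrete order with first element `c`, successor function `χ`, no last
element, and predecessors everywhere except at `c`. The map `a ↦ |χ a|` behaves like the absolute
value of a valuation: nonzero rational factors do not change it, `|χ (a + b)|` is at most the larger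
of `|χ a|` and `|χ b|`, and if these differ then `χ (a + b)` is the dominant one of `χ a`, `χ b`.
Hence a sum with distinct leading values has the sign and contraction of its dominant term.

The key fact is proved by back-and-forth between ultrapowers, which realize the countable types that
are needed (`isSaturated_uPower`). The approximations are countable `ℚ`-subspaces `G` of `M × N`,
graphs of isomorphisms closed under `χ` and under predecessors; by `IsPartialIso.of_hasLead` such a
subspace is controlled by its part in the discrete orders. To add `a`, one closes the domain under
all values `χ (a - α)`, with `α` in the domain. This only requires elements of `χ(M^{<0})`, whose
whole orbits are matched with orbits in the same cut (`IsChainIso.exists_cut`,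
`IsChainIso.union_orbit`). An image `b` must then solve the equations `χ' (b - β) = γ` corresponding
to the values `χ (a - α)`. Their solution sets are convex and meet pairwise
(`IsPartialIso.exists_chi_add_eq`), so any finitely many have a common point, and saturation yields
`b` (`IsCountableIso.exists_mem_of_forall_chi_sub`). -/

namespace Pdg

/-! # Saturation of ultrapowers, and back-and-forth -/

section ModelTheory

open FirstOrder.Language Filter

/-- A diagonal argument: countably many conditions which are finitely satisfiable for eventually
all indices have a common solution for eventually all indices. -/
theorem exists_eventually_forall {M : Type*} [Nonempty M] {l : Filter ℕ} (hl : l ≤ atTop)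
    (Q : ℕ → ℕ → M → Prop) (h : ∀ n, ∀ᶠ i in l, ∃ x, ∀ k < n, Q k i x) :
    ∃ x : ℕ → M, ∀ k, ∀ᶠ i in l, Q k i (x i) := by
  classical
  -- At the index `i`, take a solution of the longest initial segment of conditions, of length at
  -- most `i`, that is solvable there.
  have h0 : ∀ i, ∃ x, ∀ k < Nat.findGreatest (fun n => ∃ x, ∀ k < n, Q k i x) i, Q k i x :=
    fun i => Nat.findGreatest_spec (P := fun n => ∃ x, ∀ k < n, Q k i x) (Nat.zero_le i)
      ⟨Classical.arbitrary M, fun k hk => absurd hk (Nat.not_lt_zero k)⟩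
  choose x hx using h0
  refine ⟨x, fun k => ?_⟩
  filter_upwards [h (k + 1), hl (eventually_ge_atTop (k + 1))] with i hi hik
  exact hx i k (Nat.le_findGreatest (P := fun n => ∃ x, ∀ k < n, Q k i x) hik hi)

variable {L' : FirstOrder.Language.{0, 0}}

/-- The ultrapower of `M` over a nonprincipal ultrafilter on `ℕ`. -/
abbrev UPower (M : Type*) : Type _ := (hyperfilter ℕ : Filter ℕ).Product fun _ => M

/-- The diagonal map into the ultrapower. -/
noncomputable def diag {M : Type*} (a : M) : UPower M := ((fun _ => a : ℕ → M) : UPower M)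

theorem realize_diag {M : Type*} [Nonempty M] [L'.Structure M] {α : Type*} (φ : L'.Formula α)
    (x : α → M) : φ.Realize (diag ∘ x) ↔ φ.Realize x := by
  refine (Ultraproduct.realize_formula_cast (u := hyperfilter ℕ) φ fun i _ => x i).trans ?_
  simp

/-- The diagonal embedding into the ultrapower. -/
noncomputable def diagEmbedding (M : Type*) [Nonempty M] [L'.Structure M] : M ↪ₑ[L'] UPower M :=
  ⟨diag, fun _ φ x => realize_diag φ x⟩

/-- Ultrapowers are saturated for countably many instances of a formula. -/
theorem uPower_saturated {M : Type*} [Nonempty M] [L'.Structure M] {α : Type*}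
    (φ : L'.Formula (α ⊕ Unit)) (p : ℕ → α → UPower M)
    (h : ∀ n, ∃ x : UPower M, ∀ k < n, φ.Realize (Sum.elim (p k) fun _ => x)) :
    ∃ x : UPower M, ∀ k, φ.Realize (Sum.elim (p k) fun _ => x) := by
  have hrep : ∀ k a, ∃ f : ℕ → M, (f : UPower M) = p k a := fun k a => Quotient.exists_rep (p k a)
  choose f hf using hrep
  -- Łoś's theorem, applied to chosen representatives of the parameters.
  have key : ∀ (k : ℕ) (x : ℕ → M), φ.Realize (Sum.elim (p k) fun _ => (x : UPower M)) ↔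
      ∀ᶠ i in (hyperfilter ℕ : Filter ℕ), φ.Realize (Sum.elim (fun a => f k a i) fun _ => x i) := by
    intro k x
    have := Ultraproduct.realize_formula_cast (u := hyperfilter ℕ) φ (Sum.elim (f k) fun _ => x)
    convert! this using 2
    · ext j
      rcases j with j | j
      · exact (hf k j).symm
      · rfl
    · ext i
      refine iff_of_eq (congrArg _ ?_)
      ext j
      rcases j with j | j <;> rfl
  obtain ⟨x, hx⟩ := exists_eventually_forall (l := (hyperfilter ℕ : Filter ℕ))
    (Nat.hyperfilter_le_atTop)
    (fun k i x => φ.Realize (Sum.elim (fun a => f k a i) fun _ => x)) (fun n => by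
      obtain ⟨x, hx⟩ := h n
      obtain ⟨y, rfl⟩ := Quotient.exists_rep x
      have := fun k (hk : k < n) => (key k y).1 (hx k hk)
      have h2 : ∀ᶠ i in (hyperfilter ℕ : Filter ℕ), ∀ k ∈ Finset.range n,
          φ.Realize (Sum.elim (fun a => f k a i) fun _ => y i) :=
        (eventually_all_finset _).2 fun k hk => this k (Finset.mem_range.1 hk)
      filter_upwards [h2] with i hi
      exact ⟨y i, fun k hk => hi k (Finset.mem_range.2 hk)⟩)
  exact ⟨(x : UPower M), fun k => (key k x).2 (hx k)⟩

/-- Formulas are invariant under a back-and-forth system of relations. -/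
theorem realize_iff_of_backAndForth {M N : Type*} [L'.Structure M] [L'.Structure N]
    (P : Set (M × N) → Prop)
    (hfun : ∀ G, P G → ∀ {n} (f : L'.Functions n) (x : Fin n → M) (y : Fin n → N),
      (∀ i, (x i, y i) ∈ G) → (Structure.funMap f x, Structure.funMap f y) ∈ G)
    (hrel : ∀ G, P G → ∀ {n} (r : L'.Relations n) (x : Fin n → M) (y : Fin n → N),
      (∀ i, (x i, y i) ∈ G) → (Structure.RelMap r x ↔ Structure.RelMap r y))
    (hinj : ∀ G, P G → ∀ z ∈ G, ∀ w ∈ G, z.1 = w.1 ↔ z.2 = w.2)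
    (forth : ∀ G, P G → ∀ a, ∃ b G', P G' ∧ G ⊆ G' ∧ (a, b) ∈ G')
    (back : ∀ G, P G → ∀ b, ∃ a G', P G' ∧ G ⊆ G' ∧ (a, b) ∈ G')
    {α : Type*} {n : ℕ} (φ : L'.BoundedFormula α n) (G : Set (M × N)) (hG : P G)
    (v : α → M) (w : α → N) (x : Fin n → M) (y : Fin n → N)
    (hv : ∀ i, (v i, w i) ∈ G) (hx : ∀ i, (x i, y i) ∈ G) : φ.Realize v x ↔ φ.Realize w y := by
  have hterm : ∀ (G : Set (M × N)), P G → ∀ {β : Type _} (t : L'.Term β) (v : β → M) (w : β → N),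
      (∀ i, (v i, w i) ∈ G) → (t.realize v, t.realize w) ∈ G := by
    intro G hG β t v w hv
    induction t with
    | var i => exact hv i
    | func f ts ih => exact hfun G hG f _ _ ih
  have helim : ∀ (G : Set (M × N)) {n : ℕ} (x : Fin n → M) (y : Fin n → N),
      (∀ i, (v i, w i) ∈ G) → (∀ i, (x i, y i) ∈ G) →
      ∀ i, (Sum.elim v x i, Sum.elim w y i) ∈ G := by
    rintro G n x y hv hx (i | i)
    · exact hv i
    · exact hx i
  induction φ generalizing G with
  | falsum => exact Iff.rfl
  | equal s t =>
    have h := hinj G hG _ (hterm G hG s _ _ (helim G x y hv hx)) _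
      (hterm G hG t _ _ (helim G x y hv hx))
    exact h
  | rel r ts => exact hrel G hG r _ _ fun i => hterm G hG (ts i) _ _ (helim G x y hv hx)
  | imp φ ψ ih1 ih2 => exact imp_congr (ih1 G hG x y hv hx) (ih2 G hG x y hv hx)
  | all φ ih =>
    have hs : ∀ (G : Set (M × N)) {n : ℕ} (x : Fin n → M) (y : Fin n → N) (a : M) (b : N),
        (∀ i, (x i, y i) ∈ G) → (a, b) ∈ G → ∀ i, ((Fin.snoc x a : Fin (n + 1) → M) i,
          (Fin.snoc y b : Fin (n + 1) → N) i) ∈ G := by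
      intro G n x y a b hx hab i
      refine Fin.lastCases ?_ (fun i => ?_) i
      · simpa using hab
      · simpa using hx i
    constructor
    · intro h b
      obtain ⟨a, G', hG', hGG', hab⟩ := back G hG b
      exact (ih G' hG' _ _ (fun i => hGG' (hv i))
        (hs G' x y a b (fun i => hGG' (hx i)) hab)).1 (h a)
    · intro h a
      obtain ⟨b, G', hG', hGG', hab⟩ := forth G hG a
      exact (ih G' hG' _ _ (fun i => hGG' (hv i))
        (hs G' x y a b (fun i => hGG' (hx i)) hab)).2 (h b)

end ModelTheory

/-! # Divisible ordered groups as rational vector spaces -/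

section RatModule

variable {Γ : Type*} [AddCommGroup Γ] [IsAddTorsionFree Γ]

/-- A divisible torsion-free abelian group is a vector space over `ℚ`. -/
@[reducible]
noncomputable def ratModule (h : ∀ n : ℕ, n ≠ 0 → ∀ a : Γ, ∃ b : Γ, n • b = a) : Module ℚ Γ :=
  let f : ℚ → Γ → Γ := fun q a => (h q.den q.den_nz (q.num • a)).choose
  have hf : ∀ q a, (q.den : ℤ) • f q a = q.num • a := fun q a => by
    rw [natCast_zsmul]; exact (h q.den q.den_nz (q.num • a)).choose_spec
  -- Torsion-freeness lets any fraction `m / n` representing `q` determine `f q a`, so each module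
  -- axiom reduces to clearing denominators.
  have huniq : ∀ (n m : ℤ) (q : ℚ) (a b : Γ), n ≠ 0 → n * q = m → n • b = m • a → f q a = b := by
    intro n m q a b hn hq hb
    have hd : (q.den : ℤ) ≠ 0 := by exact_mod_cast q.den_nz
    refine zsmul_right_injective (mul_ne_zero hn hd) ?_
    have : m * q.den = n * q.num := by
      have h1 : (m : ℚ) * q.den = n * q.num := by
        rw [← hq, mul_assoc, Rat.mul_den_eq_num]
      exact_mod_cast h1
    change (n * (q.den : ℤ)) • f q a = (n * (q.den : ℤ)) • b
    rw [mul_smul, hf, ← mul_smul, ← this, mul_comm m, mul_comm n, mul_smul, mul_smul, hb]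
  { smul := f
    one_smul := fun a => huniq 1 1 1 a a one_ne_zero (by simp) rfl
    mul_smul := fun p q a => by
      refine huniq (p.den * q.den) (p.num * q.num) _ _ _
        (by exact_mod_cast mul_ne_zero p.den_nz q.den_nz) ?_ ?_
      · push_cast
        rw [← Rat.mul_den_eq_num p, ← Rat.mul_den_eq_num q]
        ring
      · change _ • f p (f q a) = _
        rw [mul_comm (p.den : ℤ), mul_smul, hf, smul_comm, hf, mul_smul]
    smul_zero := fun q =>
      huniq q.den q.num q 0 0 (by exact_mod_cast q.den_nz) (by
        rw [mul_comm]; exact_mod_cast Rat.mul_den_eq_num q) (by simp)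
    smul_add := fun q a b => huniq q.den q.num q _ _ (by exact_mod_cast q.den_nz) (by
        rw [mul_comm]; exact_mod_cast Rat.mul_den_eq_num q) (by
          change _ • (f q a + f q b) = _
          rw [smul_add, hf, hf, smul_add])
    add_smul := fun p q a => by
      refine huniq (p.den * q.den) (p.num * q.den + q.num * p.den) _ _ _
        (by exact_mod_cast mul_ne_zero p.den_nz q.den_nz) ?_ ?_
      · push_cast
        rw [← Rat.mul_den_eq_num p, ← Rat.mul_den_eq_num q]
        ring
      · change _ • (f p a + f q a) = _
        rw [smul_add, mul_smul _ _ (f q a), hf, mul_comm (p.den : ℤ), mul_smul, hf, add_smul,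
          mul_comm p.num, mul_comm q.num, mul_smul, mul_smul]
    zero_smul := fun a => huniq 1 0 0 a 0 one_ne_zero (by simp) (by simp) }

end RatModule

/-! # Basic facts on precontraction discrete groups -/

namespace IsPdg

section Basic

variable {Γ : Type*} [AddCommGroup Γ] [LinearOrder Γ] [IsOrderedAddMonoid Γ]
  {χ : Γ → Γ} {c : Γ}

theorem chi_zero (h : IsPdg χ c) : χ 0 = 0 := (h.eq_zero_iff 0).2 rfl

theorem chi_pos_iff (h : IsPdg χ c) {a : Γ} : 0 < χ a ↔ 0 < a := by
  constructor
  · intro ha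
    by_contra hn
    have := h.monotone _ _ (not_lt.1 hn)
    rw [h.chi_zero] at this
    exact this.not_gt ha
  · intro ha
    have := h.monotone _ _ ha.le
    rw [h.chi_zero] at this
    exact this.lt_of_ne fun h' => ha.ne' ((h.eq_zero_iff a).1 h'.symm)

theorem chi_neg_iff (h : IsPdg χ c) {a : Γ} : χ a < 0 ↔ a < 0 := by
  rw [← neg_pos, ← h.map_neg, h.chi_pos_iff, neg_pos]

theorem chi_abs (h : IsPdg χ c) (a : Γ) : χ |a| = |χ a| := by
  rcases le_or_gt 0 a with ha | ha
  · have := h.monotone _ _ ha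
    rw [h.chi_zero] at this
    rw [abs_of_nonneg ha, abs_of_nonneg this]
  · rw [abs_of_neg ha, abs_of_neg (h.chi_neg_iff.2 ha), h.map_neg]

theorem chi_nsmul (h : IsPdg χ c) {n : ℕ} (hn : n ≠ 0) (a : Γ) : χ (n • a) = χ a := by
  refine h.arch _ _ (ArchimedeanClass.mk_eq_mk.2 ⟨⟨1, ?_⟩, n, ?_⟩) ?_
  · rw [one_smul, abs_nsmul]
    exact le_self_nsmul (abs_nonneg a) hn
  · rw [abs_nsmul]
  · rcases lt_trichotomy a 0 with ha | rfl | ha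
    · rw [sign_neg ha, sign_neg (by simpa using nsmul_pos (neg_pos.2 ha) hn)]
    · simp
    · rw [sign_pos ha, sign_pos (nsmul_pos ha hn)]

/-- For `0 < a`, monotonicity and `χ (2 • |b|) = χ |b|` force `2 • |b| < a`. Then `a + b ≤ 2 • a`
and `a ≤ 2 • (a + b)`, and `χ` ignores the factor `2`. The case `a < 0` follows by oddness. -/
theorem chi_add_of_abs_lt (h : IsPdg χ c) {a b : Γ} (hab : |χ b| < |χ a|) :
    χ (a + b) = χ a := by
  have key : ∀ a b : Γ, 0 < a → |χ b| < |χ a| → χ (a + b) = χ a := by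
    intro a b ha hab
    have hlt : 2 • |b| < a := by
      by_contra hn
      have := h.monotone _ _ (not_lt.1 hn)
      rw [h.chi_nsmul two_ne_zero, h.chi_abs] at this
      rw [abs_of_pos (h.chi_pos_iff.2 ha)] at hab
      exact this.not_gt hab
    have h1 := neg_abs_le b
    have h2 := le_abs_self b
    have h0 := abs_nonneg b
    have hlt' : |b| + |b| < a := by rwa [two_nsmul] at hlt
    have hb : |b| < a := lt_of_le_of_lt (le_add_of_nonneg_left h0) hlt'
    apply le_antisymm
    · rw [← h.chi_nsmul two_ne_zero a, two_nsmul]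
      exact h.monotone _ _ (by gcongr; exact h2.trans hb.le)
    · rw [← h.chi_nsmul two_ne_zero (a + b), two_nsmul]
      refine h.monotone _ _ ?_
      have h3 : a + (-|b| + -|b|) ≤ a + (b + b) := by gcongr
      have h4 : 0 ≤ a + (-|b| + -|b|) := by
        rw [← neg_add, ← sub_eq_add_neg, sub_nonneg]
        exact hlt'.le
      calc a ≤ a + (a + (b + b)) := le_add_of_nonneg_right (h4.trans h3)
        _ = a + b + (a + b) := by abel
  rcases lt_trichotomy a 0 with ha | rfl | ha
  · have := key (-a) (-b) (neg_pos.2 ha) (by rwa [h.map_neg, h.map_neg, abs_neg, abs_neg])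
    rw [← neg_add, h.map_neg, h.map_neg] at this
    exact neg_injective this
  · rw [h.chi_zero, abs_zero] at hab
    exact absurd hab (abs_nonneg _).not_gt
  · exact key a b ha hab

theorem lt_chi (h : IsPdg χ c) {a : Γ} (ha : a < 0) : a < χ a := by
  have := h.abs_lt a ha.ne
  rw [abs_of_neg ha, abs_of_neg (h.chi_neg_iff.2 ha)] at this
  exact neg_lt_neg_iff.1 this

theorem neg_of_mem (h : IsPdg χ c) {d : Γ} (hd : d ∈ χ '' Set.Iio 0) : d < 0 := by
  obtain ⟨a, ha, rfl⟩ := hd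
  exact h.chi_neg_iff.2 ha

theorem chi_mem (h : IsPdg χ c) {d : Γ} (hd : d ∈ χ '' Set.Iio 0) : χ d ∈ χ '' Set.Iio 0 :=
  ⟨d, h.neg_of_mem hd, rfl⟩

theorem c_mem (h : IsPdg χ c) : c ∈ χ '' Set.Iio 0 := h.isLeast.1

theorem exists_pred (h : IsPdg χ c) {d : Γ} (hd : d ∈ χ '' Set.Iio 0) (hc : d ≠ c) :
    ∃ e ∈ χ '' Set.Iio 0, χ e = d :=
  h.bijOn.surjOn ⟨hd, (h.isLeast.2 hd).lt_of_ne hc.symm⟩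

theorem chi_ne_c (h : IsPdg χ c) {d : Γ} (hd : d ∈ χ '' Set.Iio 0) : χ d ≠ c :=
  (h.bijOn.mapsTo hd).2.ne'

theorem chi_inj (h : IsPdg χ c) {d e : Γ} (hd : d ∈ χ '' Set.Iio 0) (he : e ∈ χ '' Set.Iio 0) :
    χ d = χ e ↔ d = e := h.bijOn.injOn.eq_iff hd he

theorem lt_iff_chi_le (h : IsPdg χ c) {d e : Γ} (hd : d ∈ χ '' Set.Iio 0)
    (he : e ∈ χ '' Set.Iio 0) : d < e ↔ χ d ≤ e :=
  ⟨fun hde => (h.succ d hd e he hde).2, (h.lt_chi (h.neg_of_mem hd)).trans_le⟩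

theorem chi_lt_chi (h : IsPdg χ c) {d e : Γ} (hd : d ∈ χ '' Set.Iio 0)
    (he : e ∈ χ '' Set.Iio 0) : χ d < χ e ↔ d < e := by
  constructor
  · intro hlt
    by_contra hn
    exact (h.monotone _ _ (not_lt.1 hn)).not_gt hlt
  · intro hlt
    exact (h.monotone _ _ hlt.le).lt_of_ne fun h' => hlt.ne ((h.chi_inj hd he).1 h')

end Basic

section Smul

variable {Γ : Type*} [AddCommGroup Γ] [LinearOrder Γ] [IsOrderedAddMonoid Γ] [Module ℚ Γ]
  {χ : Γ → Γ} {c : Γ}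

theorem chi_smul_of_pos (h : IsPdg χ c) {q : ℚ} (hq : 0 < q) (a : Γ) : χ (q • a) = χ a := by
  have h1 : q.den • q • a = q.num.toNat • a := by
    rw [← Nat.cast_smul_eq_nsmul ℚ, smul_smul, Rat.den_mul_eq_num, ← Nat.cast_smul_eq_nsmul ℚ]
    congr 1
    rw [← Int.cast_natCast, Int.toNat_of_nonneg (Rat.num_pos.2 hq).le]
  rw [← h.chi_nsmul q.den_nz, h1, h.chi_nsmul]
  have := Rat.num_pos.2 hq
  omega

theorem chi_smul_of_neg (h : IsPdg χ c) {q : ℚ} (hq : q < 0) (a : Γ) : χ (q • a) = -χ a := by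
  rw [← h.chi_smul_of_pos (neg_pos.2 hq) a, neg_smul, h.map_neg, neg_neg]

end Smul

end IsPdg

/-! # Partial isomorphisms -/

section PartialIso

variable {M N : Type*} [AddCommGroup M] [LinearOrder M] [IsOrderedAddMonoid M]
  [AddCommGroup N] [LinearOrder N] [IsOrderedAddMonoid N]
  {χ : M → M} {c : M} {χ' : N → N} {c' : N}

/-- `E` is the graph of a partial isomorphism between the discrete orders `χ(M^{<0})` and
`χ'(N^{<0})` whose domain and codomain are closed under successors and predecessors. -/
structure IsChainIso (χ : M → M) (c : M) (χ' : N → N) (c' : N) (E : Set (M × N)) : Prop where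
  c_mem : (c, c') ∈ E
  fst_mem : ∀ z ∈ E, z.1 ∈ χ '' Set.Iio 0
  snd_mem : ∀ z ∈ E, z.2 ∈ χ' '' Set.Iio 0
  lt_iff : ∀ z ∈ E, ∀ w ∈ E, z.1 < w.1 ↔ z.2 < w.2
  chi_mem : ∀ z ∈ E, (χ z.1, χ' z.2) ∈ E
  pred : ∀ z ∈ E, ∀ d ∈ χ '' Set.Iio 0, χ d = z.1 →
    ∃ e ∈ χ' '' Set.Iio 0, χ' e = z.2 ∧ (d, e) ∈ E
  pred' : ∀ z ∈ E, ∀ e ∈ χ' '' Set.Iio 0, χ' e = z.2 →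
    ∃ d ∈ χ '' Set.Iio 0, χ d = z.1 ∧ (d, e) ∈ E

namespace IsChainIso

variable {E : Set (M × N)}

theorem swap (hE : IsChainIso χ c χ' c' E) : IsChainIso χ' c' χ c (Prod.swap ⁻¹' E) where
  c_mem := hE.c_mem
  fst_mem _ hz := hE.snd_mem _ hz
  snd_mem _ hz := hE.fst_mem _ hz
  lt_iff _ hz _ hw := (hE.lt_iff _ hz _ hw).symm
  chi_mem _ hz := hE.chi_mem _ hz
  pred _ hz := hE.pred' _ hz
  pred' _ hz := hE.pred _ hz

theorem eq_iff (hE : IsChainIso χ c χ' c' E) {z w : M × N} (hz : z ∈ E) (hw : w ∈ E) :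
    z.1 = w.1 ↔ z.2 = w.2 := by
  have h1 := hE.lt_iff z hz w hw
  have h2 := hE.lt_iff w hw z hz
  constructor
  · intro h
    exact le_antisymm (not_lt.1 (mt h2.2 h.not_gt)) (not_lt.1 (mt h1.2 h.not_lt))
  · intro h
    exact le_antisymm (not_lt.1 (mt h2.1 h.not_gt)) (not_lt.1 (mt h1.1 h.not_lt))

end IsChainIso

variable [Module ℚ M] [Module ℚ N]

/-- `G` is the graph of a partial isomorphism between `ℚ`-subspaces of `M` and `N` which contain
the distinguished constants, and are closed under the contractions, and under taking predecessors
in `χ(M^{<0})` and `χ'(N^{<0})`. -/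
structure IsPartialIso (χ : M → M) (c : M) (χ' : N → N) (c' : N) (G : Submodule ℚ (M × N)) :
    Prop where
  c_mem : (c, c') ∈ G
  pos_iff : ∀ z ∈ G, 0 < z.1 ↔ 0 < z.2
  chi_mem : ∀ z ∈ G, (χ z.1, χ' z.2) ∈ G
  pred : ∀ z ∈ G, ∀ d ∈ χ '' Set.Iio 0, χ d = z.1 →
    ∃ e ∈ χ' '' Set.Iio 0, χ' e = z.2 ∧ (d, e) ∈ G
  pred' : ∀ z ∈ G, ∀ e ∈ χ' '' Set.Iio 0, χ' e = z.2 →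
    ∃ d ∈ χ '' Set.Iio 0, χ d = z.1 ∧ (d, e) ∈ G

/-- The graph with the two sides exchanged. -/
def swapGraph (G : Submodule ℚ (M × N)) : Submodule ℚ (N × M) :=
  G.comap (LinearEquiv.prodComm ℚ N M).toLinearMap

/-- The restriction of a graph to `χ(M^{<0})`. -/
def chain (χ : M → M) (G : Submodule ℚ (M × N)) : Set (M × N) := {z | z ∈ G ∧ z.1 ∈ χ '' Set.Iio 0}

namespace IsPartialIso

variable {G : Submodule ℚ (M × N)}

theorem swap (hG : IsPartialIso χ c χ' c' G) : IsPartialIso χ' c' χ c (swapGraph G) where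
  c_mem := hG.c_mem
  pos_iff _ hz := (hG.pos_iff _ hz).symm
  chi_mem _ hz := hG.chi_mem _ hz
  pred _ hz := hG.pred' _ hz
  pred' _ hz := hG.pred _ hz

theorem lt_iff (hG : IsPartialIso χ c χ' c' G) {z w : M × N} (hz : z ∈ G) (hw : w ∈ G) :
    z.1 < w.1 ↔ z.2 < w.2 := by
  have := hG.pos_iff _ (sub_mem hw hz)
  simpa using this

theorem eq_iff (hG : IsPartialIso χ c χ' c' G) {z w : M × N} (hz : z ∈ G) (hw : w ∈ G) :
    z.1 = w.1 ↔ z.2 = w.2 := by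
  have h1 := hG.lt_iff hz hw
  have h2 := hG.lt_iff hw hz
  constructor
  · intro h
    exact le_antisymm (not_lt.1 (mt h2.2 h.not_gt)) (not_lt.1 (mt h1.2 h.not_lt))
  · intro h
    exact le_antisymm (not_lt.1 (mt h2.1 h.not_gt)) (not_lt.1 (mt h1.1 h.not_lt))

/-- Closure under predecessors is what transfers membership: `z.1` is the predecessor of `χ z.1`, so
its partner is a predecessor of `χ' z.2`, and this partner can only be `z.2`. -/
theorem snd_mem (hG : IsPartialIso χ c χ' c' G) {z : M × N}
    (hz : z ∈ G) (hd : z.1 ∈ χ '' Set.Iio 0) : z.2 ∈ χ' '' Set.Iio 0 := by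
  obtain ⟨e, he, -, hde⟩ := hG.pred _ (hG.chi_mem z hz) z.1 hd rfl
  have : e = z.2 := (hG.eq_iff hde hz).1 rfl
  exact this ▸ he

theorem isChainIso (h : IsPdg χ c) (hG : IsPartialIso χ c χ' c' G) :
    IsChainIso χ c χ' c' (chain χ G) where
  c_mem := ⟨hG.c_mem, h.c_mem⟩
  fst_mem _ hz := hz.2
  snd_mem _ hz := hG.snd_mem hz.1 hz.2
  lt_iff _ hz _ hw := hG.lt_iff hz.1 hw.1
  chi_mem z hz := ⟨hG.chi_mem z hz.1, h.chi_mem hz.2⟩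
  pred z hz d hd hdz := by
    obtain ⟨e, he, hez, hde⟩ := hG.pred z hz.1 d hd hdz
    exact ⟨e, he, hez, hde, hd⟩
  pred' z hz e he hez := by
    obtain ⟨d, hd, hdz, hde⟩ := hG.pred' z hz.1 e he hez
    exact ⟨d, hd, hdz, hde, hd⟩

end IsPartialIso

/-- The contractions of both components of `z` are, up to a common sign, related by `E`. -/
def HasLead (χ : M → M) (χ' : N → N) (E : Set (M × N)) (z : M × N) : Prop :=
  ∃ w ∈ E, (χ z.1, χ' z.2) = w ∨ (χ z.1, χ' z.2) = -w

theorem HasLead.mono {E E' : Set (M × N)} (hEE : E ⊆ E') {z : M × N} (hz : HasLead χ χ' E z) :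
    HasLead χ χ' E' z := by
  obtain ⟨w, hw, h⟩ := hz
  exact ⟨w, hEE hw, h⟩

theorem HasLead.smul (h : IsPdg χ c) (h' : IsPdg χ' c') {E : Set (M × N)} {z : M × N}
    (hz : HasLead χ χ' E z) {q : ℚ} (hq : q ≠ 0) : HasLead χ χ' E (q • z) := by
  obtain ⟨w, hw, hz⟩ := hz
  refine ⟨w, hw, ?_⟩
  rcases hq.lt_or_gt with hq | hq
  · rw [Prod.smul_fst, Prod.smul_snd, h.chi_smul_of_neg hq, h'.chi_smul_of_neg hq]
    rcases hz with hz | hz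
    · right
      rw [← hz]
      rfl
    · left
      rw [← neg_neg w, ← hz]
      rfl
  · rwa [Prod.smul_fst, Prod.smul_snd, h.chi_smul_of_pos hq, h'.chi_smul_of_pos hq]

theorem IsPartialIso.hasLead (h : IsPdg χ c) {G : Submodule ℚ (M × N)}
    (hG : IsPartialIso χ c χ' c' G) {z : M × N} (hz : z ∈ G) (hz0 : z ≠ 0) :
    HasLead χ χ' (chain χ G) z := by
  have h0 : z.1 ≠ 0 := fun h0 =>
    hz0 (Prod.ext h0 ((hG.eq_iff hz (zero_mem G)).1 h0))
  rcases h0.lt_or_gt with hneg | hpos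
  · exact ⟨_, ⟨hG.chi_mem z hz, z.1, hneg, rfl⟩, Or.inl rfl⟩
  · refine ⟨_, ⟨neg_mem (hG.chi_mem z hz), -z.1, neg_lt_zero.2 hpos, h.map_neg _⟩,
      Or.inr (neg_neg _).symm⟩

/-- Contractions preserve signs and both components of a pair in `E` are negative, so the common
sign in `HasLead` decides. -/
theorem IsChainIso.pos_iff_of_hasLead (h : IsPdg χ c) (h' : IsPdg χ' c') {E : Set (M × N)}
    (hE : IsChainIso χ c χ' c' E) {z : M × N} (hz : HasLead χ χ' E z) : 0 < z.1 ↔ 0 < z.2 := by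
  obtain ⟨w, hw, hz⟩ := hz
  have h1 := h.neg_of_mem (hE.fst_mem w hw)
  have h2 := h'.neg_of_mem (hE.snd_mem w hw)
  rw [← h.chi_pos_iff, ← h'.chi_pos_iff]
  rcases hz with hz | hz
  · rw [show χ z.1 = w.1 from congrArg Prod.fst hz, show χ' z.2 = w.2 from congrArg Prod.snd hz]
    exact iff_of_false h1.not_gt h2.not_gt
  · rw [show χ z.1 = -w.1 from congrArg Prod.fst hz, show χ' z.2 = -w.2 from congrArg Prod.snd hz]
    exact iff_of_true (neg_pos.2 h1) (neg_pos.2 h2)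

/-- Elements of `χ(M^{<0})` are determined by their contractions: `z.1` is the predecessor of some
`w.1`, so `E` already contains a pair `(z.1, e)`. Subtracting it from `z` gives `e = z.2`, since
positivity agrees on both sides. -/
theorem IsChainIso.mem_of_hasLead (h : IsPdg χ c) {E : Set (M × N)}
    (hE : IsChainIso χ c χ' c' E) {G : Submodule ℚ (M × N)} (hEG : E ⊆ G)
    (hpos : ∀ z ∈ G, 0 < z.1 ↔ 0 < z.2) {z : M × N} (hzG : z ∈ G)
    (hz : HasLead χ χ' E z) (hd : z.1 ∈ χ '' Set.Iio 0) : z ∈ E := by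
  obtain ⟨w, hw, hz⟩ := hz
  have h1 := h.neg_of_mem (hE.fst_mem w hw)
  have hneg : χ z.1 < 0 := h.chi_neg_iff.2 (h.neg_of_mem hd)
  have hzw : (χ z.1, χ' z.2) = w := by
    refine hz.resolve_right fun hz => ?_
    rw [show χ z.1 = -w.1 from congrArg Prod.fst hz, neg_lt_zero] at hneg
    exact hneg.not_gt h1
  obtain ⟨e, he, -, hze⟩ := hE.pred w hw z.1 hd (congrArg Prod.fst hzw)
  have he : e = z.2 := by
    have h1 := hpos _ (sub_mem hzG (hEG hze))
    have h2 := hpos _ (sub_mem (hEG hze) hzG)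
    simp only [Prod.fst_sub, Prod.snd_sub, sub_self, lt_irrefl, false_iff, sub_pos, not_lt]
      at h1 h2
    exact le_antisymm h2 h1 |>.symm ▸ rfl
  rwa [he] at hze

/-- The criterion behind every extension step. Leading terms in `E` determine the signs and
contractions, and by `IsChainIso.mem_of_hasLead` the subspace contains no elements of the discrete
orders beyond those of `E`, so predecessors are found in `E`. -/
theorem IsPartialIso.of_hasLead (h : IsPdg χ c) (h' : IsPdg χ' c') {E : Set (M × N)}
    (hE : IsChainIso χ c χ' c' E) {G : Submodule ℚ (M × N)} (hEG : E ⊆ G)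
    (hlead : ∀ z ∈ G, z ≠ 0 → HasLead χ χ' E z) : IsPartialIso χ c χ' c' G := by
  have hpos : ∀ z ∈ G, 0 < z.1 ↔ 0 < z.2 := by
    intro z hz
    by_cases h0 : z = 0
    · simp [h0]
    · exact hE.pos_iff_of_hasLead h h' (hlead z hz h0)
  refine ⟨hEG hE.c_mem, hpos, ?_, ?_, ?_⟩
  · intro z hz
    by_cases h0 : z = 0
    · simp only [h0, Prod.fst_zero, Prod.snd_zero, h.chi_zero, h'.chi_zero]
      exact zero_mem G
    · obtain ⟨w, hw, hzw | hzw⟩ := hlead z hz h0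
      · rw [hzw]
        exact hEG hw
      · rw [hzw]
        exact neg_mem (hEG hw)
  · intro z hz d hd hdz
    have hzd : z.1 ∈ χ '' Set.Iio 0 := hdz ▸ h.chi_mem hd
    have h0 : z ≠ 0 := by
      rintro rfl
      exact (h.neg_of_mem hzd).ne rfl
    have hzE := hE.mem_of_hasLead h hEG hpos hz (hlead z hz h0) hzd
    obtain ⟨e, he, hez, hde⟩ := hE.pred z hzE d hd hdz
    exact ⟨e, he, hez, hEG hde⟩
  · intro z hz e he hez
    have hze : z.2 ∈ χ' '' Set.Iio 0 := hez ▸ h'.chi_mem he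
    have h0 : z ≠ 0 := by
      rintro rfl
      exact (h'.neg_of_mem hze).ne rfl
    have hlz : HasLead χ' χ (Prod.swap ⁻¹' E) z.swap := by
      obtain ⟨w, hw, hzw⟩ := hlead z hz h0
      exact ⟨w.swap, hw, hzw.imp (congrArg Prod.swap) (congrArg Prod.swap)⟩
    have hzE : z.swap ∈ Prod.swap ⁻¹' E := hE.swap.mem_of_hasLead h' (G := swapGraph G)
      (fun w hw => hEG hw) (fun w hw => (hpos _ hw).symm) hz hlz hze
    obtain ⟨d, hd, hdz, hde⟩ := hE.pred' z hzE e he hez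
    exact ⟨d, hd, hdz, hEG hde⟩

/-- A sum of two pairs with distinct leading terms has the leading term of one of them. -/
theorem IsChainIso.chi_add (h : IsPdg χ c) (h' : IsPdg χ' c') {E : Set (M × N)}
    (hE : IsChainIso χ c χ' c' E) {z₁ z₂ w₁ w₂ : M × N} (hw₁ : w₁ ∈ E) (hw₂ : w₂ ∈ E)
    (hne : w₁ ≠ w₂) (hz₁ : (χ z₁.1, χ' z₁.2) = w₁ ∨ (χ z₁.1, χ' z₁.2) = -w₁)
    (hz₂ : (χ z₂.1, χ' z₂.2) = w₂ ∨ (χ z₂.1, χ' z₂.2) = -w₂) :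
    (χ (z₁ + z₂).1, χ' (z₁ + z₂).2) = (χ z₁.1, χ' z₁.2) ∨
      (χ (z₁ + z₂).1, χ' (z₁ + z₂).2) = (χ z₂.1, χ' z₂.2) := by
  have habs : ∀ z w : M × N, w ∈ E → ((χ z.1, χ' z.2) = w ∨ (χ z.1, χ' z.2) = -w) →
      |χ z.1| = -w.1 ∧ |χ' z.2| = -w.2 := by
    intro z w hw hz
    have h1 := h.neg_of_mem (hE.fst_mem _ hw)
    have h2 := h'.neg_of_mem (hE.snd_mem _ hw)
    rcases hz with hz | hz
    · rw [show χ z.1 = w.1 from congrArg Prod.fst hz,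
        show χ' z.2 = w.2 from congrArg Prod.snd hz, abs_of_neg h1, abs_of_neg h2]
      exact ⟨rfl, rfl⟩
    · rw [show χ z.1 = -w.1 from congrArg Prod.fst hz,
        show χ' z.2 = -w.2 from congrArg Prod.snd hz, abs_neg, abs_neg,
        abs_of_neg h1, abs_of_neg h2]
      exact ⟨rfl, rfl⟩
  obtain ⟨a₁, b₁⟩ := habs z₁ w₁ hw₁ hz₁
  obtain ⟨a₂, b₂⟩ := habs z₂ w₂ hw₂ hz₂
  -- `E` is the graph of an order isomorphism, so the same summand dominates in both components.
  have hij : w₁.1 ≠ w₂.1 := fun hij => hne (Prod.ext hij ((hE.eq_iff hw₁ hw₂).1 hij))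
  rcases hij.lt_or_gt with hlt | hlt
  · left
    have hlt2 := (hE.lt_iff _ hw₁ _ hw₂).1 hlt
    rw [Prod.fst_add, Prod.snd_add, h.chi_add_of_abs_lt (by rw [a₁, a₂]; exact neg_lt_neg hlt),
      h'.chi_add_of_abs_lt (by rw [b₁, b₂]; exact neg_lt_neg hlt2)]
  · right
    have hlt2 := (hE.lt_iff _ hw₂ _ hw₁).1 hlt
    rw [add_comm, Prod.fst_add, Prod.snd_add,
      h.chi_add_of_abs_lt (by rw [a₁, a₂]; exact neg_lt_neg hlt),
      h'.chi_add_of_abs_lt (by rw [b₁, b₂]; exact neg_lt_neg hlt2)]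

/-- A sum of pairs with distinct leading terms has the leading term of one of them. -/
theorem IsChainIso.exists_chi_sum (h : IsPdg χ c) (h' : IsPdg χ' c') {E : Set (M × N)}
    (hE : IsChainIso χ c χ' c' E) {ι : Type*} {s : Finset ι} (hs : s.Nonempty) (f w : ι → M × N)
    (hw : ∀ i ∈ s, w i ∈ E)
    (hf : ∀ i ∈ s, (χ (f i).1, χ' (f i).2) = w i ∨ (χ (f i).1, χ' (f i).2) = -w i)
    (hinj : ∀ i ∈ s, ∀ j ∈ s, w i = w j → i = j) :
    ∃ i ∈ s, (χ (∑ j ∈ s, f j).1, χ' (∑ j ∈ s, f j).2) = (χ (f i).1, χ' (f i).2) := by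
  classical
  induction hs using Finset.Nonempty.cons_induction with
  | singleton i => exact ⟨i, by simp⟩
  | cons i s hi hs ih =>
    obtain ⟨j, hj, hsum⟩ := ih (fun k hk => hw k (Finset.mem_cons_of_mem hk))
      (fun k hk => hf k (Finset.mem_cons_of_mem hk))
      (fun k hk l hl => hinj k (Finset.mem_cons_of_mem hk) l (Finset.mem_cons_of_mem hl))
    have hi' : i ∈ Finset.cons i s hi := Finset.mem_cons_self i s
    have hj' : j ∈ Finset.cons i s hi := Finset.mem_cons_of_mem hj
    have hij : w i ≠ w j := fun hij => hi (hinj i hi' j hj' hij ▸ hj)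
    rw [Finset.sum_cons]
    rcases hE.chi_add h h' (hw i hi') (hw j hj') hij (hf i hi')
      (hsum ▸ hf j hj') with hsum' | hsum'
    · exact ⟨i, hi', hsum'⟩
    · exact ⟨j, hj', hsum'.trans hsum⟩

/-- A partial isomorphism can be extended along an extension of its restriction to
`χ(M^{<0})`. -/
theorem IsPartialIso.sup_span (h : IsPdg χ c) (h' : IsPdg χ' c') {G : Submodule ℚ (M × N)}
    (hG : IsPartialIso χ c χ' c' G) {E : Set (M × N)} (hE : IsChainIso χ c χ' c' E)
    (hGE : chain χ G ⊆ E) : IsPartialIso χ c χ' c' (G ⊔ Submodule.span ℚ E) := by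
  classical
  refine .of_hasLead h h' hE (fun z hz => Submodule.mem_sup_right (Submodule.subset_span hz)) ?_
  intro z hz hz0
  -- Generators already in `G` are absorbed into the summand from `G`; the remaining ones cannot
  -- cancel its leading term.
  have hz' : z ∈ G ⊔ Submodule.span ℚ (E \ G) := by
    refine (sup_le le_sup_left (Submodule.span_le.2 fun w hw => ?_) :
      G ⊔ Submodule.span ℚ E ≤ _) hz
    by_cases hwG : w ∈ G
    · exact Submodule.mem_sup_left hwG
    · exact Submodule.mem_sup_right (Submodule.subset_span ⟨hw, hwG⟩)
  obtain ⟨g, hg, y, hy, rfl⟩ := Submodule.mem_sup.1 hz'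
  obtain ⟨q, hq, rfl⟩ := Submodule.mem_span_set.1 hy
  -- Distinct generators have distinct leading terms, because `χ` is injective on `χ(M^{<0})`.
  have hinj : ∀ e ∈ E, ∀ e' ∈ E, χ e.1 = χ e'.1 → e = e' := fun e he e' he' hee => by
    have h1 := (h.chi_inj (hE.fst_mem e he) (hE.fst_mem e' he')).1 hee
    exact Prod.ext h1 ((hE.eq_iff he he').1 h1)
  by_cases hq0 : q.support.Nonempty
  · have hlead : ∀ e ∈ q.support, ((χ (q e • e).1, χ' (q e • e).2) = (χ e.1, χ' e.2) ∨
        (χ (q e • e).1, χ' (q e • e).2) = -(χ e.1, χ' e.2)) := fun e he => by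
      rcases (Finsupp.mem_support_iff.1 he).lt_or_gt with hneg | hpos
      · right
        simp only [Prod.smul_fst, Prod.smul_snd, h.chi_smul_of_neg hneg,
          h'.chi_smul_of_neg hneg]
        rfl
      · left
        simp only [Prod.smul_fst, Prod.smul_snd, h.chi_smul_of_pos hpos,
          h'.chi_smul_of_pos hpos]
    obtain ⟨i, hi, hsum⟩ := hE.exists_chi_sum h h' hq0 (fun e => q e • e)
      (fun e => (χ e.1, χ' e.2)) (fun e he => hE.chi_mem e (hq he).1) hlead
      (fun e he e' he' hee => hinj e (hq he).1 e' (hq he').1 (congrArg Prod.fst hee))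
    have hi' := hsum ▸ hlead i hi
    by_cases hg0 : g = 0
    · rw [hg0, zero_add]
      exact ⟨_, hE.chi_mem i (hq hi).1, hi'⟩
    · obtain ⟨w, hw, hgw⟩ := hG.hasLead h hg hg0
      -- If the leading terms of the two summands agreed, closure of `G` under predecessors would
      -- put `i` into `G`.
      have hne : w ≠ (χ i.1, χ' i.2) := by
        rintro rfl
        obtain ⟨e, he, -, hie⟩ := hG.pred _ hw.1 i.1 (hE.fst_mem i (hq hi).1) rfl
        have hieE := hGE ⟨hie, hE.fst_mem i (hq hi).1⟩
        have : (i.1, e) = i := hinj _ hieE _ (hq hi).1 rfl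
        exact (hq hi).2 (this ▸ hie)
      rcases hE.chi_add h h' (hGE hw) (hE.chi_mem i (hq hi).1) hne hgw hi' with hs | hs
      · exact ⟨w, hGE hw, hs ▸ hgw⟩
      · exact ⟨_, hE.chi_mem i (hq hi).1, hs ▸ hi'⟩
  · have hq0' : q = 0 := by rwa [Finsupp.support_nonempty_iff, not_not] at hq0
    subst hq0'
    rw [Finsupp.sum_zero_index, add_zero] at hz0 ⊢
    exact (hG.hasLead h hg hz0).mono hGE

end PartialIso

/-! ### Iterates of the successor function -/

namespace IsPdg

variable {Γ : Type*} [AddCommGroup Γ] [LinearOrder Γ] [IsOrderedAddMonoid Γ]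
  {χ : Γ → Γ} {c : Γ}

theorem iterate_mem (h : IsPdg χ c) {d : Γ} (hd : d ∈ χ '' Set.Iio 0) (n : ℕ) :
    χ^[n] d ∈ χ '' Set.Iio 0 := by
  induction n with
  | zero => exact hd
  | succ n ih =>
    rw [Function.iterate_succ_apply']
    exact h.chi_mem ih

theorem iterate_lt_iterate (h : IsPdg χ c) {d e : Γ} (hd : d ∈ χ '' Set.Iio 0)
    (he : e ∈ χ '' Set.Iio 0) (n : ℕ) : χ^[n] d < χ^[n] e ↔ d < e := by
  induction n with
  | zero => rfl
  | succ n ih =>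
    rw [Function.iterate_succ_apply', Function.iterate_succ_apply',
      h.chi_lt_chi (h.iterate_mem hd n) (h.iterate_mem he n), ih]

theorem iterate_inj (h : IsPdg χ c) {d e : Γ} (hd : d ∈ χ '' Set.Iio 0)
    (he : e ∈ χ '' Set.Iio 0) {n : ℕ} (hde : χ^[n] d = χ^[n] e) : d = e :=
  le_antisymm (not_lt.1 fun hlt => ((h.iterate_lt_iterate he hd n).2 hlt).ne' hde)
    (not_lt.1 fun hlt => ((h.iterate_lt_iterate hd he n).2 hlt).ne hde)

theorem strictMono_iterate (h : IsPdg χ c) {d : Γ} (hd : d ∈ χ '' Set.Iio 0) :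
    StrictMono fun n : ℕ => χ^[n] d :=
  strictMono_nat_of_lt_succ fun n => by
    rw [Function.iterate_succ_apply']
    exact h.lt_chi (h.neg_of_mem (h.iterate_mem hd n))

theorem lt_chi_iff (h : IsPdg χ c) {d e : Γ} (hd : d ∈ χ '' Set.Iio 0)
    (he : e ∈ χ '' Set.Iio 0) : d < χ e ↔ d ≤ e := by
  rw [← not_le, ← h.lt_iff_chi_le he hd, not_lt]

end IsPdg

/-! ### Extending countable partial isomorphisms by one element -/

section Extension

variable {M N : Type*} [AddCommGroup M] [LinearOrder M] [IsOrderedAddMonoid M]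
  [AddCommGroup N] [LinearOrder N] [IsOrderedAddMonoid N]
  {χ : M → M} {c : M} {χ' : N → N} {c' : N}

namespace IsChainIso

variable {E : Set (M × N)}

theorem iterate_chi_mem (hE : IsChainIso χ c χ' c' E) {z : M × N} (hz : z ∈ E) (n : ℕ) :
    (χ^[n] z.1, χ'^[n] z.2) ∈ E := by
  induction n with
  | zero => exact hz
  | succ n ih =>
    rw [Function.iterate_succ_apply', Function.iterate_succ_apply']
    exact hE.chi_mem _ ih

/-- Closure under predecessors would allow a descent from `χ^[n] a` to `a`. -/
theorem ne_iterate (h : IsPdg χ c) (hE : IsChainIso χ c χ' c' E) {a : M}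
    (ha : a ∈ χ '' Set.Iio 0) (hne : ∀ z ∈ E, z.1 ≠ a) (n : ℕ) : ∀ z ∈ E, z.1 ≠ χ^[n] a := by
  induction n with
  | zero => exact hne
  | succ n ih =>
    intro z hz hza
    rw [Function.iterate_succ_apply'] at hza
    obtain ⟨e, -, -, he⟩ := hE.pred z hz _ (h.iterate_mem ha n) hza.symm
    exact ih _ he rfl

/-- The pairs of elements at corresponding positions in the orbits of `a` and `b` under successors
and predecessors. -/
def orbit (χ : M → M) (χ' : N → N) (a : M) (b : N) : Set (M × N) :=
  {z | z.1 ∈ χ '' Set.Iio 0 ∧ z.2 ∈ χ' '' Set.Iio 0 ∧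
    ∃ m n, χ^[m] z.1 = χ^[n] a ∧ χ'^[m] z.2 = χ'^[n] b}

/-- For fixed exponents `m` and `n`, injectivity of the iterates leaves at most one pair. -/
theorem countable_orbit (h : IsPdg χ c) (h' : IsPdg χ' c') (a : M) (b : N) :
    (orbit χ χ' a b).Countable := by
  have : orbit χ χ' a b ⊆ ⋃ m : ℕ, ⋃ n : ℕ, {z | z.1 ∈ χ '' Set.Iio 0 ∧ z.2 ∈ χ' '' Set.Iio 0 ∧
      χ^[m] z.1 = χ^[n] a ∧ χ'^[m] z.2 = χ'^[n] b} := by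
    rintro z ⟨h1, h2, m, n, h3⟩
    exact Set.mem_iUnion.2 ⟨m, Set.mem_iUnion.2 ⟨n, h1, h2, h3⟩⟩
  refine (Set.countable_iUnion fun m => Set.countable_iUnion fun n =>
    Set.Subsingleton.countable ?_).mono this
  rintro z ⟨h1, h2, h3, h4⟩ w ⟨k1, k2, k3, k4⟩
  exact Prod.ext (h.iterate_inj h1 k1 (h3.trans k3.symm))
    (h'.iterate_inj h2 k2 (h4.trans k4.symm))

/-- A partial isomorphism of discrete orders can be extended by two orbits which realize the same
cut. -/
theorem union_orbit (h : IsPdg χ c) (h' : IsPdg χ' c') (hE : IsChainIso χ c χ' c' E) {a : M}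
    {b : N} (ha : a ∈ χ '' Set.Iio 0) (hb : b ∈ χ' '' Set.Iio 0) (hne : ∀ z ∈ E, z.1 ≠ a)
    (hne' : ∀ z ∈ E, z.2 ≠ b) (hlt : ∀ z ∈ E, z.1 < a ↔ z.2 < b) :
    IsChainIso χ c χ' c' (E ∪ orbit χ χ' a b) := by
  have hna := hE.ne_iterate h ha hne
  have hnb : ∀ n, ∀ z ∈ E, z.2 ≠ χ'^[n] b := fun n z hz =>
    hE.swap.ne_iterate h' hb (fun w hw => hne' _ hw) n z.swap hz
  -- The cut is inherited by successors: `z < χ x` means `z ≤ x`, which is `z < x` because `x` is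
  -- not in the domain.
  have hlt_iter : ∀ n, ∀ z ∈ E, z.1 < χ^[n] a ↔ z.2 < χ'^[n] b := by
    intro n
    induction n with
    | zero => exact hlt
    | succ n ih =>
      intro z hz
      rw [Function.iterate_succ_apply', Function.iterate_succ_apply',
        h.lt_chi_iff (hE.fst_mem z hz) (h.iterate_mem ha n),
        h'.lt_chi_iff (hE.snd_mem z hz) (h'.iterate_mem hb n),
        (hna n z hz).le_iff_lt, (hnb n z hz).le_iff_lt, ih z hz]
  have hneO : ∀ z ∈ E, ∀ w ∈ orbit χ χ' a b, z.1 ≠ w.1 ∧ z.2 ≠ w.2 := by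
    rintro z hz w ⟨-, -, m, n, h3, h4⟩
    have hzm := hE.iterate_chi_mem hz m
    exact ⟨fun hzw => hna n _ hzm (by rw [← h3, hzw]), fun hzw => hnb n _ hzm (by rw [← h4, hzw])⟩
  have hEO : ∀ z ∈ E, ∀ w ∈ orbit χ χ' a b, z.1 < w.1 ↔ z.2 < w.2 := by
    rintro z hz w ⟨h1, h2, m, n, h3, h4⟩
    rw [← h.iterate_lt_iterate (hE.fst_mem z hz) h1 m,
      ← h'.iterate_lt_iterate (hE.snd_mem z hz) h2 m, h3, h4]
    exact hlt_iter n _ (hE.iterate_chi_mem hz m)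
  refine ⟨Or.inl hE.c_mem, ?_, ?_, ?_, ?_, ?_, ?_⟩
  · rintro z (hz | hz)
    · exact hE.fst_mem z hz
    · exact hz.1
  · rintro z (hz | hz)
    · exact hE.snd_mem z hz
    · exact hz.2.1
  · rintro z (hz | hz) w (hw | hw)
    · exact hE.lt_iff z hz w hw
    · exact hEO z hz w hw
    · rw [← not_le, ← not_le, (hneO w hw z hz).1.le_iff_lt, (hneO w hw z hz).2.le_iff_lt,
        hEO w hw z hz]
    · obtain ⟨h1, h2, m, n, h3, h4⟩ := hz
      obtain ⟨k1, k2, m', n', k3, k4⟩ := hw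
      -- Applying `m' + m` successors moves both points onto the forward orbits, where only the
      -- exponents `m' + n` and `m + n'` are compared.
      rw [← h.iterate_lt_iterate h1 k1 (m' + m), ← h'.iterate_lt_iterate h2 k2 (m' + m)]
      have e1 : χ^[m' + m] z.1 = χ^[m' + n] a := by
        rw [Function.iterate_add_apply, h3, ← Function.iterate_add_apply]
      have e2 : χ'^[m' + m] z.2 = χ'^[m' + n] b := by
        rw [Function.iterate_add_apply, h4, ← Function.iterate_add_apply]
      have e3 : χ^[m' + m] w.1 = χ^[m + n'] a := by
        rw [add_comm m' m, Function.iterate_add_apply, k3, ← Function.iterate_add_apply]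
      have e4 : χ'^[m' + m] w.2 = χ'^[m + n'] b := by
        rw [add_comm m' m, Function.iterate_add_apply, k4, ← Function.iterate_add_apply]
      rw [e1, e2, e3, e4]
      exact (h.strictMono_iterate ha).lt_iff_lt.trans (h'.strictMono_iterate hb).lt_iff_lt.symm
  · rintro z (hz | hz)
    · exact Or.inl (hE.chi_mem z hz)
    · obtain ⟨h1, h2, m, n, h3, h4⟩ := hz
      refine Or.inr ⟨h.chi_mem h1, h'.chi_mem h2, m, n + 1, ?_, ?_⟩
      · rw [← Function.iterate_succ_apply, Function.iterate_succ_apply',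
          Function.iterate_succ_apply', h3]
      · rw [← Function.iterate_succ_apply, Function.iterate_succ_apply',
          Function.iterate_succ_apply', h4]
  · rintro z (hz | hz) d hd hdz
    · obtain ⟨e, he, hez, hde⟩ := hE.pred z hz d hd hdz
      exact ⟨e, he, hez, Or.inl hde⟩
    -- The new orbits avoid the constants, which belong to `E`, so predecessors always exist.
    · obtain ⟨e, he, hez⟩ := h'.exists_pred hz.2.1 fun hc => (hneO _ hE.c_mem z hz).2 hc.symm
      obtain ⟨h1, h2, m, n, h3, h4⟩ := hz
      refine ⟨e, he, hez, Or.inr ⟨hd, he, m + 1, n, ?_, ?_⟩⟩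
      · rw [Function.iterate_succ_apply, hdz, h3]
      · rw [Function.iterate_succ_apply, hez, h4]
  · rintro z (hz | hz) e he hez
    · obtain ⟨d, hd, hdz, hde⟩ := hE.pred' z hz e he hez
      exact ⟨d, hd, hdz, Or.inl hde⟩
    · obtain ⟨d, hd, hdz⟩ := h.exists_pred hz.1 fun hc => (hneO _ hE.c_mem z hz).1 hc.symm
      obtain ⟨h1, h2, m, n, h3, h4⟩ := hz
      refine ⟨d, hd, hdz, Or.inr ⟨hd, he, m + 1, n, ?_, ?_⟩⟩
      · rw [Function.iterate_succ_apply, hdz, h3]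
      · rw [Function.iterate_succ_apply, hez, h4]

end IsChainIso

/-- The fragment of `ℵ₁`-saturation that is needed to extend countable partial isomorphisms. -/
structure IsSaturated (χ' : N → N) : Prop where
  exists_between : ∀ X Y : Set N, X.Countable → Y.Countable → X.Nonempty → Y.Nonempty →
    (∀ x ∈ X, ∀ y ∈ Y, x < y) → ∃ b, (∀ x ∈ X, x < b) ∧ ∀ y ∈ Y, b < y
  exists_chi : ∀ S : Set (N × N), S.Countable →
    (∀ F : Finset (N × N), ↑F ⊆ S → ∃ b, ∀ z ∈ F, χ' (b - z.1) = z.2) →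
    ∃ b, ∀ z ∈ S, χ' (b - z.1) = z.2

/-- The image of a cut in a countable partial isomorphism of discrete orders is realized in
`χ'(N^{<0})`. -/
theorem IsChainIso.exists_cut (h : IsPdg χ c) (h' : IsPdg χ' c') (hsat : IsSaturated χ')
    {E : Set (M × N)} (hE : IsChainIso χ c χ' c' E) (hcount : E.Countable) {a : M}
    (ha : a ∈ χ '' Set.Iio 0) (hne : ∀ z ∈ E, z.1 ≠ a) :
    ∃ b ∈ χ' '' Set.Iio 0, (∀ z ∈ E, z.2 ≠ b) ∧ ∀ z ∈ E, z.1 < a ↔ z.2 < b := by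
  -- This `b` need not lie in `χ'(N^{<0})`, but `χ' b` does, as the upper bound `0` makes `b`
  -- negative. The cut survives the passage to `χ' b`, since the part of `E` below `a` is closed
  -- under successors and the part above under predecessors.
  obtain ⟨b, hX, hY⟩ := hsat.exists_between (Prod.snd '' {z ∈ E | z.1 < a})
    (insert 0 (Prod.snd '' {z ∈ E | a < z.1}))
    ((hcount.mono (Set.sep_subset _ _)).image _)
    (((hcount.mono (Set.sep_subset _ _)).image _).insert 0)
    ⟨c', (c, c'), ⟨hE.c_mem, (h.isLeast.2 ha).lt_of_ne (hne _ hE.c_mem)⟩, rfl⟩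
    (Set.insert_nonempty _ _) (by
      rintro _ ⟨z, ⟨hz, hza⟩, rfl⟩ y hy
      rcases Set.mem_insert_iff.1 hy with rfl | ⟨w, ⟨hw, hwa⟩, rfl⟩
      · exact h'.neg_of_mem (hE.snd_mem z hz)
      · exact (hE.lt_iff z hz w hw).1 (hza.trans hwa))
  have hb0 : b < 0 := hY 0 (Set.mem_insert _ _)
  have h1 : ∀ z ∈ E, z.1 < a → z.2 < χ' b := by
    intro z hz hza
    exact (h'.lt_chi (h'.neg_of_mem (hE.snd_mem z hz))).trans_le
      (h'.monotone _ _ (hX _ ⟨z, ⟨hz, hza⟩, rfl⟩).le)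
  have hpred : ∀ z ∈ E, a < z.1 → ∃ w ∈ E, a < w.1 ∧ χ' w.2 = z.2 := by
    intro z hz hza
    obtain ⟨d, hd, hdz⟩ := h.exists_pred (hE.fst_mem z hz)
      ((h.isLeast.2 ha).trans_lt hza).ne'
    obtain ⟨e, he, hez, hde⟩ := hE.pred z hz d hd hdz
    refine ⟨(d, e), hde, lt_of_le_of_ne ?_ (hne _ hde).symm, hez⟩
    rwa [← hdz, h.lt_chi_iff ha hd] at hza
  have h2 : ∀ z ∈ E, a < z.1 → χ' b < z.2 := by
    intro z hz hza
    -- Two predecessors are taken because monotonicity of `χ'` gives only a weak inequality.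
    obtain ⟨w, hw, hwa, hwz⟩ := hpred z hz hza
    obtain ⟨y, hy, hya, hyw⟩ := hpred w hw hwa
    calc χ' b ≤ χ' y.2 := h'.monotone _ _ (hY _ (Set.mem_insert_of_mem _ ⟨y, ⟨hy, hya⟩, rfl⟩)).le
      _ = w.2 := hyw
      _ < χ' w.2 := h'.lt_chi (h'.neg_of_mem (hE.snd_mem w hw))
      _ = z.2 := hwz
  refine ⟨χ' b, ⟨b, hb0, rfl⟩, fun z hz => ?_, fun z hz => ⟨h1 z hz, fun hzb => ?_⟩⟩
  · rcases (hne z hz).lt_or_gt with hlt | hgt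
    · exact (h1 z hz hlt).ne
    · exact (h2 z hz hgt).ne'
  · by_contra hn
    exact hzb.not_gt (h2 z hz ((not_lt.1 hn).lt_of_ne (hne z hz).symm))

variable [Module ℚ M] [Module ℚ N]

theorem countable_sup_span {G : Submodule ℚ (M × N)} (hG : (G : Set (M × N)).Countable)
    {E : Set (M × N)} (hE : E.Countable) :
    ((G ⊔ Submodule.span ℚ E : Submodule ℚ (M × N)) : Set (M × N)).Countable := by
  have h1 : G ⊔ Submodule.span ℚ E = Submodule.span ℚ (G ∪ E) := by
    rw [Submodule.span_union, Submodule.span_eq]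
  have := (hG.union hE).to_subtype
  rw [h1]
  have h2 : Countable (Submodule.span ℚ
      (Set.range (Subtype.val : ((G : Set (M × N)) ∪ E : Set (M × N)) → M × N))) := inferInstance
  rw [Subtype.range_coe] at h2
  exact Set.countable_coe_iff.1 h2

/-- A countable partial isomorphism. -/
structure IsCountableIso (χ : M → M) (c : M) (χ' : N → N) (c' : N) (G : Submodule ℚ (M × N)) :
    Prop extends IsPartialIso χ c χ' c' G where
  countable : (G : Set (M × N)).Countable

namespace IsCountableIso

variable {G : Submodule ℚ (M × N)}

theorem swap (hG : IsCountableIso χ c χ' c' G) : IsCountableIso χ' c' χ c (swapGraph G) :=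
  ⟨hG.toIsPartialIso.swap, hG.countable.preimage Prod.swap_injective⟩

/-- The orbit of `a` is matched with that of an element in the corresponding cut, and the linear
span follows by `IsPartialIso.sup_span`. -/
theorem exists_mem_of_mem_image (h : IsPdg χ c) (h' : IsPdg χ' c') (hsat : IsSaturated χ')
    (hG : IsCountableIso χ c χ' c' G) {a : M} (ha : a ∈ χ '' Set.Iio 0) :
    ∃ G', IsCountableIso χ c χ' c' G' ∧ G ≤ G' ∧ ∃ b, (a, b) ∈ G' := by
  by_cases hne : ∃ b, (a, b) ∈ G
  · exact ⟨G, hG, le_rfl, hne⟩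
  have hE := hG.isChainIso h
  have hEc : (chain χ G).Countable := hG.countable.mono fun z hz => hz.1
  have hne' : ∀ z ∈ chain χ G, z.1 ≠ a := by
    rintro z hz rfl
    exact hne ⟨z.2, hz.1⟩
  obtain ⟨b, hb, hb1, hb2⟩ := hE.exists_cut h h' hsat hEc ha hne'
  have hE' := hE.union_orbit h h' ha hb hne' hb1 hb2
  exact ⟨_, ⟨hG.sup_span h h' hE' Set.subset_union_left,
    countable_sup_span hG.countable (hEc.union (IsChainIso.countable_orbit h h' a b))⟩, le_sup_left,
    b, Submodule.mem_sup_right (Submodule.subset_span (Or.inr ⟨ha, hb, 0, 0, rfl, rfl⟩))⟩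

/-- Unions of chains of countable partial isomorphisms. -/
theorem exists_iSup (R : ℕ → Submodule ℚ (M × N) → Submodule ℚ (M × N) → Prop)
    (hR : ∀ n G, IsCountableIso χ c χ' c' G → ∃ G', IsCountableIso χ c χ' c' G' ∧ G ≤ G' ∧ R n G G')
    (hG : IsCountableIso χ c χ' c' G) :
    ∃ f : ℕ → Submodule ℚ (M × N), f 0 = G ∧ Monotone f ∧ (∀ n, R n (f n) (f (n + 1))) ∧
      IsCountableIso χ c χ' c' (⨆ n, f n) := by
  choose! g hg1 hg2 hg3 using hR
  let f : ℕ → Submodule ℚ (M × N) := fun n => Nat.rec G (fun n G => g n G) n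
  have hf : ∀ n, IsCountableIso χ c χ' c' (f n) := by
    intro n
    induction n with
    | zero => exact hG
    | succ n ih => exact hg1 n _ ih
  have hmono : Monotone f := monotone_nat_of_le_succ fun n => hg2 n _ (hf n)
  refine ⟨f, rfl, hmono, fun n => hg3 n _ (hf n), ?_⟩
  have hmem : ∀ z, z ∈ ⨆ n, f n ↔ ∃ n, z ∈ f n := fun z =>
    Submodule.mem_iSup_of_directed _ hmono.directed_le
  refine ⟨⟨(hmem _).2 ⟨0, hG.c_mem⟩, ?_, ?_, ?_, ?_⟩, ?_⟩
  · intro z hz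
    obtain ⟨n, hn⟩ := (hmem z).1 hz
    exact (hf n).pos_iff z hn
  · intro z hz
    obtain ⟨n, hn⟩ := (hmem z).1 hz
    exact (hmem _).2 ⟨n, (hf n).chi_mem z hn⟩
  · intro z hz d hd hdz
    obtain ⟨n, hn⟩ := (hmem z).1 hz
    obtain ⟨e, he, hez, hde⟩ := (hf n).pred z hn d hd hdz
    exact ⟨e, he, hez, (hmem _).2 ⟨n, hde⟩⟩
  · intro z hz e he hez
    obtain ⟨n, hn⟩ := (hmem z).1 hz
    obtain ⟨d, hd, hdz, hde⟩ := (hf n).pred' z hn e he hez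
    exact ⟨d, hd, hdz, (hmem _).2 ⟨n, hde⟩⟩
  · rw [Submodule.coe_iSup_of_directed _ hmono.directed_le]
    exact Set.countable_iUnion fun n => (hf n).countable

/-- The elements of `D` are adjoined one by one along an enumeration. -/
theorem exists_forall_mem (h : IsPdg χ c) (h' : IsPdg χ' c') (hsat : IsSaturated χ')
    (hG : IsCountableIso χ c χ' c' G) {D : Set M} (hD : D.Countable) (hD' : D ⊆ χ '' Set.Iio 0) :
    ∃ G', IsCountableIso χ c χ' c' G' ∧ G ≤ G' ∧ ∀ d ∈ D, ∃ e, (d, e) ∈ G' := by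
  rcases D.eq_empty_or_nonempty with rfl | hne
  · exact ⟨G, hG, le_rfl, fun d hd => hd.elim⟩
  obtain ⟨d, rfl⟩ := hD.exists_eq_range hne
  obtain ⟨f, hf0, -, hf, hf'⟩ := exists_iSup (G := G) (fun n _ G' => ∃ e, (d n, e) ∈ G')
    (fun n G hG => hG.exists_mem_of_mem_image h h' hsat (hD' ⟨n, rfl⟩)) hG
  refine ⟨_, hf', hf0 ▸ le_iSup f 0, ?_⟩
  rintro _ ⟨n, rfl⟩
  obtain ⟨e, he⟩ := hf n
  exact ⟨e, (le_iSup f (n + 1)) he⟩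

/-- The domain of a countable partial isomorphism can be enlarged so as to contain the values
`χ (a - α)` for all `α` in the domain. -/
theorem exists_chi_sub_mem (h : IsPdg χ c) (h' : IsPdg χ' c') (hsat : IsSaturated χ')
    (hG : IsCountableIso χ c χ' c' G) (a : M) :
    ∃ G', IsCountableIso χ c χ' c' G' ∧ G ≤ G' ∧ ∀ z ∈ G', ∃ e, (χ (a - z.1), e) ∈ G' := by
  -- Each stage adjoins the values for the preceding domain. Countably many stages suffice, as every
  -- `α` in the union occurs at a finite one.
  obtain ⟨f, hf0, hmono, hf, hf'⟩ := exists_iSup (G := G)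
    (fun _ G G' => ∀ z ∈ G, ∃ e, (χ (a - z.1), e) ∈ G') (fun _ G hG => by
      -- Only negative elements lie in `χ(M^{<0})`, so a positive value is adjoined through its
      -- negative.
      let D : Set M := ((fun z : M × N => χ (a - z.1)) '' G ∪ (fun z : M × N => -χ (a - z.1)) '' G) ∩
        χ '' Set.Iio 0
      have hD : D.Countable :=
        ((hG.countable.image _).union (hG.countable.image _)).mono Set.inter_subset_left
      obtain ⟨G', hG', hGG', hD'⟩ := hG.exists_forall_mem h h' hsat hD Set.inter_subset_right
      refine ⟨G', hG', hGG', fun z hz => ?_⟩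
      rcases lt_trichotomy (a - z.1) 0 with hlt | heq | hgt
      · exact hD' _ ⟨Or.inl ⟨z, hz, rfl⟩, _, hlt, rfl⟩
      · rw [heq, h.chi_zero]
        exact ⟨0, zero_mem G'⟩
      · obtain ⟨e, he⟩ := hD' (-χ (a - z.1))
          ⟨Or.inr ⟨z, hz, rfl⟩, _, neg_lt_zero.2 hgt, h.map_neg _⟩
        exact ⟨-e, by simpa using neg_mem he⟩) hG
  refine ⟨_, hf', hf0 ▸ le_iSup f 0, fun z hz => ?_⟩
  obtain ⟨n, hn⟩ := (Submodule.mem_iSup_of_directed _ hmono.directed_le).1 hz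
  obtain ⟨e, he⟩ := hf n z hn
  exact ⟨e, (le_iSup f (n + 1)) he⟩

end IsCountableIso

/-- Finitely many pairwise intersecting convex subsets of a linear order have a common point. -/
theorem exists_mem_of_ordConnected {ι : Type*} {s : Finset ι} (hs : s.Nonempty) (C : ι → Set N)
    (hC : ∀ i ∈ s, (C i).OrdConnected) (hp : ∀ i ∈ s, ∀ j ∈ s, (C i ∩ C j).Nonempty) :
    ∃ b, ∀ i ∈ s, b ∈ C i := by
  have : ∀ i j, ∃ b, i ∈ s → j ∈ s → b ∈ C i ∩ C j := fun i j => by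
    by_cases hi : i ∈ s
    · by_cases hj : j ∈ s
      · obtain ⟨b, hb⟩ := hp i hi j hj
        exact ⟨b, fun _ _ => hb⟩
      · exact ⟨0, fun _ h => absurd h hj⟩
    · exact ⟨0, fun h => absurd h hi⟩
  choose p hp using this
  have hmin : ∀ i, ∃ j ∈ s, ∀ k ∈ s, p i j ≤ p i k := fun i => s.exists_min_image (p i) hs
  choose m hm hmin using hmin
  obtain ⟨i, hi, hmax⟩ := s.exists_max_image (fun i => p i (m i)) hs
  -- The largest of the minima `p k (m k)` works: for each `k` it lies between `p k (m k)` and `p i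
  -- k`, both in `C k`.
  exact ⟨p i (m i), fun k hk => (hC k hk).out (hp k (m k) hk (hm k)).1 (hp i k hi hk).2
    ⟨hmax k hk, hmin i k hk⟩⟩

namespace IsPartialIso

variable {G : Submodule ℚ (M × N)}

theorem abs_mem (hG : IsPartialIso χ c χ' c' G) {z : M × N} (hz : z ∈ G) : (|z.1|, |z.2|) ∈ G := by
  rcases lt_or_ge 0 z.1 with hpos | hneg
  · rw [abs_of_pos hpos, abs_of_pos ((hG.pos_iff z hz).1 hpos)]
    exact hz
  · rw [abs_of_nonpos hneg, abs_of_nonpos (not_lt.1 (mt (hG.pos_iff z hz).2 hneg.not_gt))]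
    exact neg_mem hz

theorem abs_lt_iff (hG : IsPartialIso χ c χ' c' G) {z w : M × N} (hz : z ∈ G) (hw : w ∈ G) :
    |z.1| < |w.1| ↔ |z.2| < |w.2| :=
  hG.lt_iff (hG.abs_mem hz) (hG.abs_mem hw)

/-- A nonzero value of `χ` lies, up to sign, in `χ(M^{<0})`, and `G` preserves this set. -/
theorem exists_chi_eq (h : IsPdg χ c) (h' : IsPdg χ' c') (hG : IsPartialIso χ c χ' c' G)
    {w : M × N} (hw : w ∈ G) {x : M} (hx : χ x = w.1) : ∃ y, χ' y = w.2 := by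
  rcases lt_trichotomy x 0 with hneg | rfl | hpos
  · obtain ⟨y, -, hy⟩ := hG.snd_mem hw ⟨x, hneg, hx⟩
    exact ⟨y, hy⟩
  · refine ⟨0, ?_⟩
    rw [h'.chi_zero]
    rw [h.chi_zero] at hx
    exact (hG.eq_iff (zero_mem G) hw).1 hx
  · obtain ⟨y, -, hy⟩ := hG.snd_mem (neg_mem hw)
      ⟨-x, neg_lt_zero.2 hpos, by rw [h.map_neg, hx]; rfl⟩
    exact ⟨-y, by rw [h'.map_neg, hy]; exact neg_neg _⟩

/-- Two conditions on the contractions of translates of an element can be transferred along a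
partial isomorphism. -/
theorem exists_chi_add_eq (h : IsPdg χ c) (h' : IsPdg χ' c') (hG : IsPartialIso χ c χ' c' G)
    {u w₁ w₂ : M × N} (hu : u ∈ G) (hw₁ : w₁ ∈ G) (hw₂ : w₂ ∈ G) {x : M}
    (hx₁ : χ (x + u.1) = w₁.1) (hx₂ : χ x = w₂.1) :
    ∃ y, χ' (y + u.2) = w₁.2 ∧ χ' y = w₂.2 := by
  have hχu := hG.chi_mem u hu
  have heq : ∀ {w w' : M × N}, w ∈ G → w' ∈ G → w.1 = w'.1 → w.2 = w'.2 :=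
    fun hw hw' => (hG.eq_iff hw hw').1
  -- If `u` or `x` dominates, `χ (x + u)` is forced, and any `y` with the right contraction works.
  rcases lt_trichotomy |χ u.1| |χ x| with hlt | habs | hgt
  · obtain ⟨y, hy⟩ := hG.exists_chi_eq h h' hw₂ hx₂
    refine ⟨y, ?_, hy⟩
    rw [h.chi_add_of_abs_lt hlt, hx₂] at hx₁
    rw [hx₂] at hlt
    rw [h'.chi_add_of_abs_lt (hy ▸ (hG.abs_lt_iff hχu hw₂).1 hlt), hy]
    exact heq hw₂ hw₁ hx₁
  · rcases lt_trichotomy |χ (x + u.1)| |χ u.1| with hlt | habs' | hgt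
    · obtain ⟨y, hy⟩ := hG.exists_chi_eq h h' hw₁ hx₁
      -- Here `x` is `-u` up to a smaller error `x + u`, so `y` is chosen as `-u` plus an element
      -- with the contraction prescribed for the error.
      refine ⟨y - u.2, by rwa [sub_add_cancel], ?_⟩
      have hx : χ (-u.1 + (x + u.1)) = χ (-u.1) :=
        h.chi_add_of_abs_lt (by rwa [h.map_neg, abs_neg])
      rw [show -u.1 + (x + u.1) = x by abel, hx₂] at hx
      rw [hx₁] at hlt
      rw [sub_eq_neg_add, h'.chi_add_of_abs_lt]
      · exact heq (hG.chi_mem _ (neg_mem hu)) hw₂ hx.symm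
      · rw [h'.map_neg, abs_neg, hy]
        exact (hG.abs_lt_iff hw₁ hχu).1 hlt
    · -- a rational multiple of `u` does it
      suffices ∃ q : ℚ, χ ((q + 1) • u.1) = χ (x + u.1) ∧ χ (q • u.1) = χ x by
        obtain ⟨q, hq1, hq2⟩ := this
        refine ⟨q • u.2, ?_, ?_⟩
        · have := heq (hG.chi_mem _ (G.smul_mem (q + 1) hu)) hw₁ (hq1.trans hx₁)
          change χ' ((q + 1) • u.2) = w₁.2 at this
          rwa [add_smul, one_smul] at this
        · exact heq (hG.chi_mem _ (G.smul_mem q hu)) hw₂ (hq2.trans hx₂)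
      -- For `u ≠ 0` the signs of `x` and `x + u` relative to `u` select `q > 0`, `-1 < q < 0` or `q
      -- < -1`. The fourth combination, with `x` agreeing with `u` in sign but `x + u` opposite,
      -- forces `u = 0`.
      rcases abs_eq_abs.1 habs with h1 | h1 <;> rcases abs_eq_abs.1 habs' with h2 | h2
      · refine ⟨1, ?_, ?_⟩
        · rw [h.chi_smul_of_pos (by norm_num), h2]
        · rw [h.chi_smul_of_pos (by norm_num), h1]
      · have hu0 : u.1 = 0 := by
          rcases lt_trichotomy u.1 0 with hu0 | hu0 | hu0
          · have hx0 : x < 0 := h.chi_neg_iff.1 (h1 ▸ h.chi_neg_iff.2 hu0)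
            have := h.chi_neg_iff.2 (add_neg hx0 hu0)
            rw [h2, neg_lt_zero, h.chi_pos_iff] at this
            exact absurd hu0 this.not_gt
          · exact hu0
          · have hx0 : 0 < x := h.chi_pos_iff.1 (h1 ▸ h.chi_pos_iff.2 hu0)
            have := h.chi_pos_iff.2 (add_pos hx0 hu0)
            rw [h2, neg_pos, h.chi_neg_iff] at this
            exact absurd hu0 this.not_gt
        refine ⟨0, ?_, ?_⟩
        · rw [h2, hu0, smul_zero, h.chi_zero, neg_zero]
        · rw [← h1, hu0, smul_zero]
      · refine ⟨-1 / 2, ?_, ?_⟩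
        · rw [h.chi_smul_of_pos (by norm_num), h2]
        · rw [h.chi_smul_of_neg (by norm_num), h1, neg_neg]
      · refine ⟨-2, ?_, ?_⟩
        · rw [h.chi_smul_of_neg (by norm_num), h2]
        · rw [h.chi_smul_of_neg (by norm_num), h1, neg_neg]
    -- If `x + u` dominated `u`, subtracting `u` would give `χ x = χ (x + u)`, contradicting `|χ u|
    -- = |χ x|`.
    · have := h.chi_add_of_abs_lt (a := x + u.1) (b := -u.1) (by rwa [h.map_neg, abs_neg])
      rw [add_neg_cancel_right] at this
      rw [← this, habs] at hgt
      exact absurd hgt (lt_irrefl _)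
  · obtain ⟨y, hy⟩ := hG.exists_chi_eq h h' hw₂ hx₂
    refine ⟨y, ?_, hy⟩
    rw [add_comm, h.chi_add_of_abs_lt hgt] at hx₁
    rw [hx₂] at hgt
    rw [add_comm, h'.chi_add_of_abs_lt (hy ▸ (hG.abs_lt_iff hw₂ hχu).1 hgt)]
    exact heq hχu hw₁ hx₁

end IsPartialIso

namespace IsCountableIso

variable {G : Submodule ℚ (M × N)}

/-- Elements whose distances to the domain are already known can be added to the domain. -/
theorem exists_mem_of_forall_chi_sub (h : IsPdg χ c) (h' : IsPdg χ' c') (hsat : IsSaturated χ')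
    (hG : IsCountableIso χ c χ' c' G) {a : M} (ha : ∀ z ∈ G, ∃ e, (χ (a - z.1), e) ∈ G) :
    ∃ G', IsCountableIso χ c χ' c' G' ∧ G ≤ G' ∧ ∃ b, (a, b) ∈ G' := by
  by_cases hne : ∃ b, (a, b) ∈ G
  · exact ⟨G, hG, le_rfl, hne⟩
  choose! w hw using ha
  have hfin : ∀ F : Finset (M × N), ↑F ⊆ (G : Set (M × N)) →
      ∃ b, ∀ z ∈ F, χ' (b - z.2) = w z := by
    intro F hF
    rcases F.eq_empty_or_nonempty with rfl | hF0
    · exact ⟨0, by simp⟩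
    -- The solution sets are convex because `χ'` is monotone; pairwise consistency is witnessed in
    -- `M` by `a` itself.
    refine exists_mem_of_ordConnected hF0 (fun z => {b | χ' (b - z.2) = w z}) ?_ ?_
    · refine fun z _ => ⟨fun x hx y hy t ht => le_antisymm ?_ ?_⟩
      · exact (h'.monotone _ _ (sub_le_sub_right ht.2 _)).trans_eq hy
      · exact (Eq.ge hx).trans (h'.monotone _ _ (sub_le_sub_right ht.1 _))
    · intro z hz z' hz'
      obtain ⟨y, hy1, hy2⟩ := hG.exists_chi_add_eq h h' (sub_mem (hF hz') (hF hz)) (hw z (hF hz))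
        (hw z' (hF hz')) (x := a - z'.1) (by rw [Prod.fst_sub]; congr 1; abel) rfl
      refine ⟨y + z'.2, ?_, ?_⟩
      · change χ' (y + z'.2 - z.2) = w z
        rw [show y + z'.2 - z.2 = y + (z' - z).2 by rw [Prod.snd_sub]; abel]
        exact hy1
      · change χ' (y + z'.2 - z'.2) = w z'
        rwa [add_sub_cancel_right]
  obtain ⟨b, hb⟩ := hsat.exists_chi ((fun z => (z.2, w z)) '' G) (hG.countable.image _) (by
    classical
    intro F hF
    obtain ⟨F', hF', rfl⟩ := Finset.subset_set_image_iff.1 hF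
    obtain ⟨b, hb⟩ := hfin F' hF'
    refine ⟨b, fun y hy => ?_⟩
    obtain ⟨z, hz, rfl⟩ := Finset.mem_image.1 hy
    exact hb z hz)
  have hb' : ∀ z ∈ G, χ' (b - z.2) = w z := fun z hz => hb _ ⟨z, hz, rfl⟩
  have hE := hG.isChainIso h
  -- All leading terms of the new elements already occur in `G`, so the discrete part does not grow.
  have hlead : ∀ z ∈ G, HasLead χ χ' (chain χ G) ((a, b) - z) := by
    intro z hz
    have hpair : (χ ((a, b) - z).1, χ' ((a, b) - z).2) = (χ (a - z.1), w z) :=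
      Prod.ext rfl (hb' z hz)
    rcases lt_trichotomy (a - z.1) 0 with hlt | heq | hgt
    · exact ⟨_, ⟨hw z hz, _, hlt, rfl⟩, Or.inl hpair⟩
    · exact absurd ⟨z.2, (sub_eq_zero.1 heq) ▸ hz⟩ hne
    · exact ⟨_, ⟨neg_mem (hw z hz), _, neg_lt_zero.2 hgt, h.map_neg _⟩,
        Or.inr (hpair.trans (neg_neg _).symm)⟩
  refine ⟨G ⊔ Submodule.span ℚ {(a, b)}, ⟨.of_hasLead h h' hE
    (fun z hz => Submodule.mem_sup_left hz.1) ?_, countable_sup_span hG.countable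
    (Set.countable_singleton _)⟩, le_sup_left, b,
    Submodule.mem_sup_right (Submodule.mem_span_singleton_self _)⟩
  intro z hz hz0
  obtain ⟨g, hg, y, hy, rfl⟩ := Submodule.mem_sup.1 hz
  obtain ⟨q, rfl⟩ := Submodule.mem_span_singleton.1 hy
  by_cases hq : q = 0
  · subst hq
    rw [zero_smul, add_zero] at hz0 ⊢
    exact hG.hasLead h hg hz0
  -- Write `g + q • (a, b) = q • ((a, b) - (-(q⁻¹ • g)))`.
  · have := (hlead (-(q⁻¹ • g)) (neg_mem (G.smul_mem _ hg))).smul h h' hq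
    rwa [sub_neg_eq_add, smul_add, smul_inv_smul₀ hq, add_comm] at this

theorem forth (h : IsPdg χ c) (h' : IsPdg χ' c') (hsat : IsSaturated χ')
    (hG : IsCountableIso χ c χ' c' G) (a : M) :
    ∃ G', IsCountableIso χ c χ' c' G' ∧ G ≤ G' ∧ ∃ b, (a, b) ∈ G' := by
  obtain ⟨G₁, hG₁, hGG₁, ha⟩ := hG.exists_chi_sub_mem h h' hsat a
  obtain ⟨G₂, hG₂, hGG₂, hb⟩ := hG₁.exists_mem_of_forall_chi_sub h h' hsat ha
  exact ⟨G₂, hG₂, hGG₁.trans hGG₂, hb⟩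

theorem back (h : IsPdg χ c) (h' : IsPdg χ' c') (hsat : IsSaturated χ)
    (hG : IsCountableIso χ c χ' c' G) (b : N) :
    ∃ G', IsCountableIso χ c χ' c' G' ∧ G ≤ G' ∧ ∃ a, (a, b) ∈ G' := by
  obtain ⟨G', hG', hGG', a, ha⟩ := hG.swap.forth h' h hsat b
  exact ⟨swapGraph G', hG'.swap, fun z hz => hGG' (x := z.swap) hz, a, ha⟩

end IsCountableIso

end Extension

/-! # Embeddings of models -/

section Embeddings

/-- `f` is an embedding of ordered groups which respects the contractions and constants. -/
structure IsPdgEmbedding {M N : Type*} [AddCommGroup M] [LinearOrder M] [AddCommGroup N]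
    [LinearOrder N] (χ : M → M) (c : M) (χ' : N → N) (c' : N) (f : M → N) : Prop where
  map_add : ∀ a b, f (a + b) = f a + f b
  strictMono : StrictMono f
  map_chi : ∀ a, f (χ a) = χ' (f a)
  map_c : f c = c'

variable {M N K : Type*} [AddCommGroup M] [LinearOrder M] [IsOrderedAddMonoid M]
  [AddCommGroup N] [LinearOrder N] [IsOrderedAddMonoid N]
  [AddCommGroup K] [LinearOrder K] [IsOrderedAddMonoid K]
  {χ : M → M} {c : M} {χ' : N → N} {c' : N} {χ₀ : K → K} {c₀ : K}

namespace IsPdgEmbedding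

theorem map_zero {f : M → N} (hf : IsPdgEmbedding χ c χ' c' f) : f 0 = 0 :=
  (AddMonoidHom.mk' f hf.map_add).map_zero

theorem image_mem {f : M → N} (hf : IsPdgEmbedding χ c χ' c' f) {d : M}
    (hd : d ∈ χ '' Set.Iio 0) : f d ∈ χ' '' Set.Iio 0 := by
  obtain ⟨a, ha, rfl⟩ := hd
  exact ⟨f a, hf.map_zero ▸ hf.strictMono ha, (hf.map_chi a).symm⟩

/-- Embeddings reflect membership in the discrete order. Since `χ m ≠ c`, the element `χ m` has a
predecessor `p` in the smaller model, and `f p`, `f m` are elements of `χ'(N^{<0})` with the same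
successor. -/
theorem mem_of_image_mem (h : IsPdg χ c) (h' : IsPdg χ' c') {f : M → N}
    (hf : IsPdgEmbedding χ c χ' c' f) {m : M} (hm : f m ∈ χ' '' Set.Iio 0) :
    m ∈ χ '' Set.Iio 0 := by
  have hneg : m < 0 := by
    have := h'.neg_of_mem hm
    rwa [← hf.map_zero, hf.strictMono.lt_iff_lt] at this
  have hne : χ m ≠ c := by
    intro hc
    apply h'.chi_ne_c hm
    rw [← hf.map_chi, hc, hf.map_c]
  obtain ⟨p, hp, hpm⟩ := h.exists_pred ⟨m, hneg, rfl⟩ hne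
  have : f p = f m := by
    rw [← h'.chi_inj (hf.image_mem hp) hm, ← hf.map_chi, ← hf.map_chi, hpm]
  exact hf.strictMono.injective this ▸ hp

/-- The image of an embedding is closed under predecessors. Naming `c` matters here: it ensures that
an element without a predecessor does not acquire one in the larger model. -/
theorem exists_pred (h : IsPdg χ c) (h' : IsPdg χ' c') {f : M → N}
    (hf : IsPdgEmbedding χ c χ' c' f) {m : M} {d : N} (hd : d ∈ χ' '' Set.Iio 0)
    (hdm : χ' d = f m) : ∃ p ∈ χ '' Set.Iio 0, χ p = m ∧ f p = d := by
  have hm : f m ∈ χ' '' Set.Iio 0 := hdm ▸ h'.chi_mem hd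
  have hne : m ≠ c := by
    rintro rfl
    exact h'.chi_ne_c hd (hdm.trans hf.map_c)
  obtain ⟨p, hp, hpm⟩ := h.exists_pred (hf.mem_of_image_mem h h' hm) hne
  refine ⟨p, hp, hpm, ?_⟩
  rw [← h'.chi_inj (hf.image_mem hp) hd, ← hf.map_chi, hpm, hdm]

/-- Two embeddings of a countable structure define a countable partial isomorphism. -/
theorem isCountableIso [Module ℚ M] [Module ℚ N] [Module ℚ K] [Countable K] (h : IsPdg χ c)
    (h' : IsPdg χ' c') (h₀ : IsPdg χ₀ c₀) {f : K → M} {g : K → N}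
    (hf : IsPdgEmbedding χ₀ c₀ χ c f) (hg : IsPdgEmbedding χ₀ c₀ χ' c' g) :
    ∃ G, IsCountableIso χ c χ' c' G ∧ ∀ k, (f k, g k) ∈ G := by
  let F : K →ₗ[ℚ] M × N := (AddMonoidHom.mk' f hf.map_add).toRatLinearMap.prod
    (AddMonoidHom.mk' g hg.map_add).toRatLinearMap
  have hF : ∀ k, F k = (f k, g k) := fun k => rfl
  have hmem : ∀ k, (f k, g k) ∈ LinearMap.range F := fun k => ⟨k, rfl⟩
  refine ⟨LinearMap.range F, ⟨⟨?_, ?_, ?_, ?_, ?_⟩, ?_⟩, hmem⟩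
  · rw [← hf.map_c, ← hg.map_c]
    exact hmem _
  · rintro _ ⟨k, rfl⟩
    rw [hF]
    change 0 < f k ↔ 0 < g k
    rw [← hf.map_zero, ← hg.map_zero, hf.strictMono.lt_iff_lt, hg.strictMono.lt_iff_lt]
  · rintro _ ⟨k, rfl⟩
    rw [hF]
    change (χ (f k), χ' (g k)) ∈ _
    rw [← hf.map_chi, ← hg.map_chi]
    exact hmem _
  · rintro _ ⟨k, rfl⟩ d hd hdk
    obtain ⟨p, hp, rfl, rfl⟩ := hf.exists_pred h₀ h hd hdk
    exact ⟨g p, hg.image_mem hp, (hg.map_chi p).symm, hmem p⟩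
  · rintro _ ⟨k, rfl⟩ d hd hdk
    obtain ⟨p, hp, rfl, rfl⟩ := hg.exists_pred h₀ h' hd hdk
    exact ⟨f p, hf.image_mem hp, (hf.map_chi p).symm, hmem p⟩
  · rw [LinearMap.coe_range]
    exact Set.countable_range _

end IsPdgEmbedding

open FirstOrder.Language

theorem isPdgEmbedding_of_embedding [S : L.Structure M] [S' : L.Structure N]
    (hS : S = struct χ c) (hS' : S' = struct χ' c') (f : M ↪[L] N) :
    IsPdgEmbedding χ c χ' c' f := by
  subst hS hS'
  let _ := struct χ c
  let _ := struct χ' c'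
  refine ⟨fun a b => ?_, fun a b hab => ?_, fun a => ?_, ?_⟩
  · exact f.map_fun Func.add ![a, b]
  · exact (f.map_rel Rel.lt ![a, b]).2 hab
  · exact f.map_fun Func.chi ![a]
  · exact f.map_fun Func.c ![]

/-- An embedding in the sense of ordered groups is an embedding of structures. -/
theorem nonempty_embedding_of_isPdgEmbedding [S : L.Structure M] [S' : L.Structure N]
    (hS : S = struct χ c) (hS' : S' = struct χ' c') {f : M → N}
    (hf : IsPdgEmbedding χ c χ' c' f) : Nonempty (M ↪[L] N) := by
  subst hS hS'
  let _ := struct χ c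
  let _ := struct χ' c'
  refine ⟨⟨⟨f, hf.strictMono.injective⟩, fun {n} F x => ?_, fun {n} R x => ?_⟩⟩
  · cases F with
    | zero => exact hf.map_zero
    | c => exact hf.map_c
    | neg => exact (AddMonoidHom.mk' f hf.map_add).map_neg (x 0)
    | chi => exact hf.map_chi (x 0)
    | add => exact hf.map_add (x 0) (x 1)
  · cases R with
    | lt => exact hf.strictMono.lt_iff_lt

/-- Formulas are invariant under countable partial isomorphisms of saturated models. -/
theorem realize_iff_of_isCountableIso [Module ℚ M] [Module ℚ N] [S : L.Structure M]
    [S' : L.Structure N] (hS : S = struct χ c) (hS' : S' = struct χ' c') (h : IsPdg χ c)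
    (h' : IsPdg χ' c') (hsat : IsSaturated χ) (hsat' : IsSaturated χ')
    {G : Submodule ℚ (M × N)} (hG : IsCountableIso χ c χ' c' G) {α : Type*} (φ : L.Formula α)
    (v : α → M) (w : α → N) (hvw : ∀ i, (v i, w i) ∈ G) : φ.Realize v ↔ φ.Realize w := by
  subst hS hS'
  let _ := struct χ c
  let _ := struct χ' c'
  refine realize_iff_of_backAndForth
    (fun s : Set (M × N) => ∃ G : Submodule ℚ (M × N), IsCountableIso χ c χ' c' G ∧ s = G)
    ?_ ?_ ?_ ?_ ?_ φ (G : Set (M × N)) ⟨G, hG, rfl⟩ v w default default hvw fun i => i.elim0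
  · rintro _ ⟨G, hG, rfl⟩ n f x y hxy
    cases f with
    | zero => exact zero_mem G
    | c => exact hG.c_mem
    | neg => exact neg_mem (hxy 0)
    | chi => exact hG.chi_mem _ (hxy 0)
    | add => exact add_mem (hxy 0) (hxy 1)
  · rintro _ ⟨G, hG, rfl⟩ n r x y hxy
    cases r with
    | lt => exact hG.lt_iff (hxy 0) (hxy 1)
  · rintro _ ⟨G, hG, rfl⟩ z hz w hw
    exact hG.eq_iff hz hw
  · rintro _ ⟨G, hG, rfl⟩ a
    obtain ⟨G', hG', hGG', b, hb⟩ := hG.forth h h' hsat' a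
    exact ⟨b, G', ⟨G', hG', rfl⟩, hGG', hb⟩
  · rintro _ ⟨G, hG, rfl⟩ b
    obtain ⟨G', hG', hGG', a, ha⟩ := hG.back h h' hsat b
    exact ⟨a, G', ⟨G', hG', rfl⟩, hGG', ha⟩

end Embeddings

/-! # Saturation of ultrapowers of models -/

section Saturation

open FirstOrder.Language

/-- Each of the two conditions consists of countably many instances of one formula with two
parameters. -/
theorem isSaturated_uPower {M : Type*} [Nonempty M] [L.Structure M] [AddCommGroup (UPower M)]
    [LinearOrder (UPower M)] [IsOrderedAddMonoid (UPower M)] {χ : UPower M → UPower M}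
    {c : UPower M} (hS : (Ultraproduct.structure : L.Structure (UPower M)) = struct χ c)
    (h : IsPdg χ c) : IsSaturated χ := by
  have hchi : ∀ a : UPower M, oChi a = χ a := fun a => by
    unfold oChi; rw [hS]; rfl
  have hneg : ∀ a : UPower M, oNeg a = -a := fun a => by
    unfold oNeg; rw [hS]; rfl
  have hadd : ∀ a b : UPower M, oAdd a b = a + b := fun a b => by
    unfold oAdd; rw [hS]; rfl
  have hlt : ∀ a b : UPower M, oLt a b ↔ a < b := fun a b => by
    unfold oLt; rw [hS]; rfl
  let x : L.Term ((Fin 2 ⊕ Unit) ⊕ Fin 0) := Term.var (Sum.inl (Sum.inr ()))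
  let y : Fin 2 → L.Term ((Fin 2 ⊕ Unit) ⊕ Fin 0) := fun i => Term.var (Sum.inl (Sum.inl i))
  constructor
  · intro X Y hX hY hX0 hY0 hXY
    obtain ⟨p, hp⟩ := (hX.prod hY).exists_eq_range (hX0.prod hY0)
    have hφ : ∀ (q : Fin 2 → UPower M) (b : UPower M),
        Formula.Realize (fLt (y 0) x ⊓ fLt x (y 1) : L.Formula (Fin 2 ⊕ Unit))
          (Sum.elim q fun _ => b) ↔ q 0 < b ∧ b < q 1 := by
      intro q b
      rw [Formula.Realize, BoundedFormula.realize_inf, realize_fLt, realize_fLt, hlt, hlt]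
      rfl
    have hpX : ∀ k, (p k).1 ∈ X ∧ (p k).2 ∈ Y := fun k =>
      (hp ▸ Set.mem_range_self k : p k ∈ X ×ˢ Y)
    obtain ⟨b, hb⟩ := uPower_saturated (fLt (y 0) x ⊓ fLt x (y 1) : L.Formula (Fin 2 ⊕ Unit))
      (fun k => ![(p k).1, (p k).2]) (fun n => by
        simp only [hφ]
        rcases Nat.eq_zero_or_pos n with rfl | hn
        · exact ⟨0, fun k hk => absurd hk (Nat.not_lt_zero k)⟩
        have hne : (Finset.range n).Nonempty := ⟨0, Finset.mem_range.2 hn⟩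
        obtain ⟨i, hi, hi'⟩ := (Finset.range n).exists_max_image (fun k => (p k).1) hne
        obtain ⟨j, hj, hj'⟩ := (Finset.range n).exists_min_image (fun k => (p k).2) hne
        have hij := hXY _ (hpX i).1 _ (hpX j).2
        -- The midpoint of the largest lower bound and the smallest upper bound.
        obtain ⟨b, hb⟩ := h.divisible 2 two_ne_zero ((p i).1 + (p j).2)
        rw [two_nsmul] at hb
        have h1 : (p i).1 < b := by
          by_contra hn
          have := add_le_add (not_lt.1 hn) (not_lt.1 hn)
          rw [hb, add_le_add_iff_left] at this
          exact this.not_gt hij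
        have h2 : b < (p j).2 := by
          by_contra hn
          have := add_le_add (not_lt.1 hn) (not_lt.1 hn)
          rw [hb, add_le_add_iff_right] at this
          exact this.not_gt hij
        exact ⟨b, fun k hk => ⟨(hi' k (Finset.mem_range.2 hk)).trans_lt h1,
          h2.trans_le (hj' k (Finset.mem_range.2 hk))⟩⟩)
    simp only [hφ] at hb
    obtain ⟨x₀, hx₀⟩ := hX0
    obtain ⟨y₀, hy₀⟩ := hY0
    refine ⟨b, fun x hx => ?_, fun y hy => ?_⟩
    · obtain ⟨k, hk⟩ : (x, y₀) ∈ Set.range p := hp ▸ Set.mk_mem_prod hx hy₀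
      have := (hb k).1
      rwa [hk] at this
    · obtain ⟨k, hk⟩ : (x₀, y) ∈ Set.range p := hp ▸ Set.mk_mem_prod hx₀ hy
      have := (hb k).2
      rwa [hk] at this
  · intro T hT hfin
    rcases T.eq_empty_or_nonempty with rfl | hT0
    · exact ⟨0, fun z hz => hz.elim⟩
    obtain ⟨p, rfl⟩ := hT.exists_eq_range hT0
    have hφ : ∀ (q : Fin 2 → UPower M) (b : UPower M),
        Formula.Realize (tChi (tAdd x (tNeg (y 0))) =' y 1 : L.Formula (Fin 2 ⊕ Unit))
          (Sum.elim q fun _ => b) ↔ χ (b - q 0) = q 1 := by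
      intro q b
      rw [Formula.Realize, BoundedFormula.realize_bdEqual, realize_tChi, realize_tAdd,
        realize_tNeg, hchi, hadd, hneg, ← sub_eq_add_neg]
      rfl
    obtain ⟨b, hb⟩ := uPower_saturated
      (tChi (tAdd x (tNeg (y 0))) =' y 1 : L.Formula (Fin 2 ⊕ Unit))
      (fun k => ![(p k).1, (p k).2]) (fun n => by
        classical
        simp only [hφ]
        obtain ⟨b, hb⟩ := hfin ((Finset.range n).image p) (by
          rw [Finset.coe_image]
          exact Set.image_subset_range _ _)
        exact ⟨b, fun k hk => hb _ (Finset.mem_image_of_mem p (Finset.mem_range.2 hk))⟩)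
    simp only [hφ] at hb
    refine ⟨b, ?_⟩
    rintro _ ⟨k, rfl⟩
    exact hb k

/-- Formulas with parameters in a countable model have the same truth value in all models in which
it is embedded. -/
theorem realize_iff_of_countable {M N K : Type*} [L.Structure M] [L.Structure N] [S : L.Structure K]
    (hM : M ⊨ T) (hN : N ⊨ T) (hK : K ⊨ T) [Countable K] (f : K ↪[L] M) (g : K ↪[L] N)
    {α : Type*} (φ : L.Formula α) (x : α → K) : φ.Realize (f ∘ x) ↔ φ.Realize (g ∘ x) := by
  obtain ⟨_, _, _, χ₀, c₀, hS₀⟩ := exists_eq_struct K hK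
  have : Nonempty M := ⟨f 0⟩
  have : Nonempty N := ⟨g 0⟩
  -- The diagonal embeddings are elementary, so the comparison can take place in the ultrapowers.
  have hM' : UPower M ⊨ T := (diagEmbedding (L' := L) M).theory_model_iff T |>.1 hM
  have hN' : UPower N ⊨ T := (diagEmbedding (L' := L) N).theory_model_iff T |>.1 hN
  obtain ⟨_, _, _, χ, c, hS⟩ := exists_eq_struct (UPower M) hM'
  obtain ⟨_, _, _, χ', c', hS'⟩ := exists_eq_struct (UPower N) hN'
  have h₀ : IsPdg χ₀ c₀ := (model_struct_iff χ₀ c₀).1 (hS₀ ▸ hK)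
  have h : IsPdg χ c := (model_struct_iff χ c).1 (hS ▸ hM')
  have h' : IsPdg χ' c' := (model_struct_iff χ' c').1 (hS' ▸ hN')
  let _ : Module ℚ K := ratModule h₀.divisible
  let _ : Module ℚ (UPower M) := ratModule h.divisible
  let _ : Module ℚ (UPower N) := ratModule h'.divisible
  have hf := isPdgEmbedding_of_embedding hS₀ hS ((diagEmbedding (L' := L) M).toEmbedding.comp f)
  have hg := isPdgEmbedding_of_embedding hS₀ hS' ((diagEmbedding (L' := L) N).toEmbedding.comp g)
  obtain ⟨G, hG, hmem⟩ := hf.isCountableIso h h' h₀ hg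
  rw [← realize_diag φ (f ∘ x), ← realize_diag φ (g ∘ x)]
  exact realize_iff_of_isCountableIso hS hS' h h' (isSaturated_uPower hS h)
    (isSaturated_uPower hS' h') hG φ _ _ fun i => hmem (x i)

theorem card_le_aleph0 : L.card ≤ Cardinal.aleph0 := by
  have h1 : ∀ n, Countable (L.Functions n) := fun n => by
    let f : Func n → ℕ := fun F => match F with
      | .zero => 0
      | .c => 1
      | .neg => 0
      | .chi => 1
      | .add => 0
    have hf : Function.Injective f := fun F F' h => by
      cases F <;> cases F' <;> simp_all [f]
    exact hf.countable
  have h2 : ∀ n, Countable (L.Relations n) := fun n => by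
    have : Subsingleton (Rel n) := ⟨fun R R' => by cases R; cases R'; rfl⟩
    exact (inferInstance : Countable (Rel n))
  have : Countable L.Symbols := inferInstanceAs
    (Countable ((Σ n, L.Functions n) ⊕ (Σ n, L.Relations n)))
  exact Cardinal.mk_le_aleph0

/-- A countable elementary substructure of `M` containing the parameters embeds into both `M` and
`N`. -/
theorem isModelComplete : IsModelComplete.{u} T := by
  intro M N _ _ hM hN f n φ x
  obtain ⟨_, _, _, χ, c, hS⟩ := exists_eq_struct M hM
  have h : IsPdg χ c := (model_struct_iff χ c).1 (hS ▸ hM)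
  have : Nontrivial M := h.nontrivial.elim fun a ha => ⟨a, 0, ha⟩
  obtain ⟨K, hxK, hK⟩ := exists_elementarySubstructure_card_eq L (Set.range x) Cardinal.aleph0.{u}
    le_rfl
    (by
      rw [Cardinal.lift_le]
      exact (Set.countable_range x).le_aleph0)
    (by simpa using card_le_aleph0)
    (by simp)
  have : Countable K := by
    rw [← Cardinal.mk_le_aleph0_iff]
    simpa using hK.le
  have hKT : K ⊨ T := (K.subtype.theory_model_iff T).2 hM
  have hx : ∀ i, x i ∈ K := fun i => hxK ⟨i, rfl⟩
  exact realize_iff_of_countable hN hM hKT (f.comp K.subtype.toEmbedding) K.subtype.toEmbedding φ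
    fun i => ⟨x i, hx i⟩

end Saturation

/-! # Lexicographically ordered sums -/

section LexSum

variable {K : Type*} [Field K] [LinearOrder K] [IsStrictOrderedRing K]

/-- `k` is the least index of a nonzero coefficient of `a`. -/
def IsLead (a : Lex (ℕ →₀ K)) (k : ℕ) : Prop := (∀ j < k, ofLex a j = 0) ∧ ofLex a k ≠ 0

theorem exists_isLead {a : Lex (ℕ →₀ K)} (ha : a ≠ 0) : ∃ k, IsLead a k := by
  classical
  have h : ∃ k, ofLex a k ≠ 0 := by
    by_contra! h
    exact ha (congrArg toLex (Finsupp.ext h : ofLex a = 0))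
  exact ⟨Nat.find h, fun j hj => not_not.1 (Nat.find_min h hj), Nat.find_spec h⟩

theorem IsLead.neg {a : Lex (ℕ →₀ K)} {k : ℕ} (h : IsLead a k) : IsLead (-a) k :=
  ⟨fun j hj => by rw [ofLex_neg, Finsupp.neg_apply, h.1 j hj, neg_zero], by
    rw [ofLex_neg, Finsupp.neg_apply]; exact neg_ne_zero.2 h.2⟩

theorem IsLead.lt_of_lt {a b : Lex (ℕ →₀ K)} {k : ℕ} (ha : ∀ j < k, ofLex a j = 0)
    (hb : ∀ j < k, ofLex b j = 0) (hk : ofLex a k < ofLex b k) : a < b :=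
  Finsupp.Lex.lt_iff.2 ⟨k, fun j hj => (ha j hj).trans (hb j hj).symm, hk⟩

theorem IsLead.pos_iff {a : Lex (ℕ →₀ K)} {k : ℕ} (h : IsLead a k) : 0 < a ↔ 0 < ofLex a k := by
  constructor
  · intro ha
    by_contra hn
    exact ha.not_gt (IsLead.lt_of_lt h.1 (fun _ _ => rfl) ((not_lt.1 hn).lt_of_ne h.2))
  · intro ha
    exact IsLead.lt_of_lt (fun _ _ => rfl) h.1 ha

theorem IsLead.neg_iff {a : Lex (ℕ →₀ K)} {k : ℕ} (h : IsLead a k) : a < 0 ↔ ofLex a k < 0 := by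
  rw [← neg_pos, h.neg.pos_iff, ofLex_neg, Finsupp.neg_apply, neg_pos]

theorem IsLead.ne_zero {a : Lex (ℕ →₀ K)} {k : ℕ} (h : IsLead a k) : a ≠ 0 := by
  rintro rfl
  exact h.2 rfl

theorem ofLex_nsmul_apply (n : ℕ) (a : Lex (ℕ →₀ K)) (j : ℕ) :
    ofLex (n • a) j = n • ofLex a j := by
  induction n with
  | zero => rw [zero_smul, zero_smul]; rfl
  | succ n ih => rw [succ_nsmul, succ_nsmul, ← ih]; rfl

theorem IsLead.nsmul {a : Lex (ℕ →₀ K)} {k n : ℕ} (h : IsLead a k) (hn : n ≠ 0) :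
    IsLead (n • a) k :=
  ⟨fun j hj => by rw [ofLex_nsmul_apply, h.1 j hj, smul_zero], by
    rw [ofLex_nsmul_apply]; exact smul_ne_zero hn h.2⟩

/-- The leading indices of negative elements are monotone. -/
theorem IsLead.le_of_le {a b : Lex (ℕ →₀ K)} {k l : ℕ} (ha : IsLead a k) (hb : IsLead b l)
    (hab : a ≤ b) (hb0 : b < 0) : k ≤ l := by
  by_contra! hlk
  exact hab.not_gt (IsLead.lt_of_lt hb.1 (fun j hj => ha.1 j (hj.trans hlk))
    (by rw [ha.1 l hlk]; exact hb.neg_iff.1 hb0))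

theorem IsLead.abs {a : Lex (ℕ →₀ K)} {k : ℕ} (h : IsLead a k) : IsLead |a| k := by
  rcases abs_choice a with ha | ha <;> rw [ha]
  exacts [h, h.neg]

/-- The `n`th basis element of the sum. -/
noncomputable def unit (K : Type*) [Field K] (n : ℕ) : Lex (ℕ →₀ K) := toLex (Finsupp.single n 1)

theorem isLead_unit (n : ℕ) : IsLead (unit K n) n :=
  ⟨fun j hj => Finsupp.single_eq_of_ne hj.ne, by simp [unit]⟩

theorem unit_pos (n : ℕ) : 0 < unit K n := (isLead_unit n).pos_iff.2 (by simp [unit])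

theorem unit_strictAnti : StrictAnti (unit K) := fun m n hmn =>
  IsLead.lt_of_lt (k := m) (fun j hj => (isLead_unit n).1 j (hj.trans hmn)) (isLead_unit m).1
    (by rw [(isLead_unit n).1 m hmn]; exact (isLead_unit m).pos_iff.1 (unit_pos m))

/-- A lexicographically ordered sum of copies of an ordered field, together with the map which
sends an element with leading index `k` to `± e_{k+1}`, is a model. -/
theorem isPdg_lex {χ : Lex (ℕ →₀ K) → Lex (ℕ →₀ K)} (h0 : χ 0 = 0)
    (hχ : ∀ a k, IsLead a k → χ a = toLex (Finsupp.single (k + 1)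
      ((SignType.sign (ofLex a k) : SignType) : K))) :
    IsPdg χ (toLex (Finsupp.single 1 (-1))) := by
  have hneg1 : ∀ n, toLex (Finsupp.single n (-1 : K)) = -unit K n := fun n => by
    rw [unit, Finsupp.single_neg]; rfl
  have hpos : ∀ a k, IsLead a k → 0 < a → χ a = unit K (k + 1) := by
    intro a k ha ha0
    rw [hχ a k ha, sign_pos (ha.pos_iff.1 ha0)]
    rfl
  have hneg : ∀ a k, IsLead a k → a < 0 → χ a = -unit K (k + 1) := by
    intro a k ha ha0
    rw [hχ a k ha, sign_neg (ha.neg_iff.1 ha0), ← hneg1]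
    rfl
  have hmap_neg : ∀ a, χ (-a) = -χ a := by
    intro a
    rcases lt_trichotomy a 0 with ha | rfl | ha
    · obtain ⟨k, hk⟩ := exists_isLead ha.ne
      rw [hneg a k hk ha, hpos _ k hk.neg (neg_pos.2 ha), neg_neg]
    · rw [neg_zero, h0, neg_zero]
    · obtain ⟨k, hk⟩ := exists_isLead ha.ne'
      rw [hpos a k hk ha, hneg _ k hk.neg (neg_lt_zero.2 ha)]
  have hχneg : ∀ a, a < 0 → χ a < 0 := by
    intro a ha
    obtain ⟨k, hk⟩ := exists_isLead ha.ne
    rw [hneg a k hk ha, neg_lt_zero]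
    exact unit_pos _
  have hχpos : ∀ a, 0 < a → 0 < χ a := by
    intro a ha
    have := hχneg (-a) (neg_lt_zero.2 ha)
    rwa [hmap_neg, neg_lt_zero] at this
  have hmono : ∀ a b, a ≤ b → b < 0 → χ a ≤ χ b := by
    intro a b hab hb
    obtain ⟨k, hk⟩ := exists_isLead (hab.trans_lt hb).ne
    obtain ⟨l, hl⟩ := exists_isLead hb.ne
    rw [hneg a k hk (hab.trans_lt hb), hneg b l hl hb, neg_le_neg_iff]
    exact unit_strictAnti.antitone (Nat.succ_le_succ (hk.le_of_le hl hab hb))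
  -- The discrete order is the increasing sequence `-unit K 1, -unit K 2, …`, on which `χ` shifts
  -- the index by one.
  have himage : ∀ d, d ∈ χ '' Set.Iio 0 ↔ ∃ n, d = -unit K (n + 1) := by
    intro d
    constructor
    · rintro ⟨a, ha, rfl⟩
      obtain ⟨k, hk⟩ := exists_isLead (ne_of_lt (Set.mem_Iio.1 ha))
      exact ⟨k, hneg a k hk ha⟩
    · rintro ⟨n, rfl⟩
      exact ⟨-unit K n, Set.mem_Iio.2 (neg_lt_zero.2 (unit_pos n)),
        hneg _ n (isLead_unit n).neg (neg_lt_zero.2 (unit_pos n))⟩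
  have hunit : ∀ n, χ (-unit K n) = -unit K (n + 1) := fun n =>
    hneg _ n (isLead_unit n).neg (neg_lt_zero.2 (unit_pos n))
  -- Positive integer multiples keep the leading index, so archimedean equivalent elements share it.
  have hlead : ∀ {a b : Lex (ℕ →₀ K)} {k l m : ℕ}, IsLead a k → IsLead b l → |b| ≤ m • |a| →
      k ≤ l := by
    intro a b k l m hk hl hab
    have hb : 0 < |b| := abs_pos.2 hl.ne_zero
    have hm : m ≠ 0 := by
      rintro rfl
      rw [zero_smul] at hab
      exact hab.not_gt hb
    exact (hk.abs.nsmul hm).neg.le_of_le hl.abs.neg (neg_le_neg hab) (neg_lt_zero.2 hb)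
  refine { eq_zero_iff := ?_, monotone := ?_, map_neg := hmap_neg, arch := ?_, abs_lt := ?_,
           nontrivial := ⟨unit K 0, (unit_pos 0).ne'⟩, isLeast := ?_, bijOn := ?_, succ := ?_,
           divisible := ?_ }
  · intro a
    refine ⟨fun ha => ?_, fun ha => ha ▸ h0⟩
    by_contra hne
    rcases Ne.lt_or_gt hne with hlt | hgt
    · exact (hχneg a hlt).ne ha
    · exact (hχpos a hgt).ne' ha
  · intro a b hab
    rcases lt_trichotomy b 0 with hb | rfl | hb
    · exact hmono a b hab hb
    · rcases hab.lt_or_eq with ha | rfl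
      · rw [h0]
        exact (hχneg a ha).le
      · rfl
    · rcases lt_trichotomy a 0 with ha | rfl | ha
      · exact ((hχneg a ha).trans (hχpos b hb)).le
      · rw [h0]
        exact (hχpos b hb).le
      · have := hmono (-b) (-a) (neg_le_neg hab) (neg_lt_zero.2 ha)
        rwa [hmap_neg, hmap_neg, neg_le_neg_iff] at this
  · intro a b hab hs
    obtain ⟨⟨m, hm⟩, n, hn⟩ := ArchimedeanClass.mk_eq_mk.1 hab
    rcases lt_trichotomy a 0 with ha | rfl | ha
    · have hb : b < 0 := by
        rw [sign_neg ha] at hs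
        exact sign_eq_neg_one_iff.1 hs.symm
      obtain ⟨k, hk⟩ := exists_isLead ha.ne
      obtain ⟨l, hl⟩ := exists_isLead hb.ne
      rw [hneg a k hk ha, hneg b l hl hb, le_antisymm (hlead hk hl hm) (hlead hl hk hn)]
    · rw [sign_zero] at hs
      rw [sign_eq_zero_iff.1 hs.symm]
    · have hb : 0 < b := by
        rw [sign_pos ha] at hs
        exact sign_eq_one_iff.1 hs.symm
      obtain ⟨k, hk⟩ := exists_isLead ha.ne'
      obtain ⟨l, hl⟩ := exists_isLead hb.ne'
      rw [hpos a k hk ha, hpos b l hl hb, le_antisymm (hlead hk hl hm) (hlead hl hk hn)]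
  · intro a ha
    obtain ⟨k, hk⟩ := exists_isLead ha
    have h1 : |χ a| = unit K (k + 1) := by
      rcases ha.lt_or_gt with hlt | hgt
      · rw [hneg a k hk hlt, abs_neg, abs_of_pos (unit_pos _)]
      · rw [hpos a k hk hgt, abs_of_pos (unit_pos _)]
    rw [h1]
    refine IsLead.lt_of_lt (k := k) (fun j hj => (isLead_unit _).1 j (hj.trans k.lt_succ_self))
      hk.abs.1 ?_
    rw [(isLead_unit _).1 k k.lt_succ_self]
    exact hk.abs.pos_iff.1 (abs_pos.2 ha)
  · rw [hneg1]
    refine ⟨(himage _).2 ⟨0, rfl⟩, fun d hd => ?_⟩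
    obtain ⟨n, rfl⟩ := (himage d).1 hd
    exact neg_le_neg (unit_strictAnti.antitone (by omega))
  · rw [hneg1]
    refine ⟨fun d hd => ?_, fun d hd e he hde => ?_, ?_⟩
    · obtain ⟨n, rfl⟩ := (himage d).1 hd
      rw [hunit]
      exact ⟨(himage _).2 ⟨n + 1, rfl⟩, neg_lt_neg (unit_strictAnti (by omega))⟩
    · obtain ⟨m, rfl⟩ := (himage d).1 hd
      obtain ⟨n, rfl⟩ := (himage e).1 he
      rw [hunit, hunit, neg_inj, unit_strictAnti.injective.eq_iff] at hde
      rw [Nat.succ_injective hde]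
    · rintro d ⟨hd, hd1⟩
      obtain ⟨n, rfl⟩ := (himage d).1 hd
      have hn : 1 < n + 1 := unit_strictAnti.lt_iff_gt.1 (neg_lt_neg_iff.1 hd1)
      obtain ⟨m, rfl⟩ := Nat.exists_eq_add_of_lt (Nat.lt_of_succ_lt_succ hn)
      exact ⟨-unit K (m + 1), (himage _).2 ⟨m, rfl⟩, by rw [hunit]; congr 2; omega⟩
  · intro d hd e he hde
    obtain ⟨m, rfl⟩ := (himage d).1 hd
    obtain ⟨n, rfl⟩ := (himage e).1 he
    have hmn : m + 1 < n + 1 := unit_strictAnti.lt_iff_gt.1 (neg_lt_neg_iff.1 hde)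
    rw [hunit]
    exact ⟨neg_lt_neg (unit_strictAnti (by omega)),
      neg_le_neg (unit_strictAnti.antitone (by omega))⟩
  · intro n hn a
    refine ⟨toLex ((n : K)⁻¹ • ofLex a), ?_⟩
    refine Finsupp.ext (f := ofLex _) (g := ofLex a) fun j => ?_
    refine (ofLex_nsmul_apply n (toLex ((n : K)⁻¹ • ofLex a)) j).trans ?_
    rw [ofLex_toLex, Finsupp.smul_apply, nsmul_eq_mul, smul_eq_mul,
      mul_inv_cancel_left₀ (Nat.cast_ne_zero.2 hn)]

end LexSum

/-! # The rational model -/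

section Rational

theorem chiQ_zero : chiQ 0 = 0 := by
  have : ¬ (ofLex (0 : QSum)).support.Nonempty := by simp
  rw [chiQ, dif_neg this]

theorem chiQ_of_isLead {a : QSum} {k : ℕ} (h : IsLead a k) :
    chiQ a = toLex (Finsupp.single (k + 1) ((SignType.sign (ofLex a k) : SignType) : ℚ)) := by
  have hk : k ∈ (ofLex a).support := Finsupp.mem_support_iff.2 h.2
  have hne : (ofLex a).support.Nonempty := ⟨k, hk⟩
  have hmin : (ofLex a).support.min' hne = k := by
    refine le_antisymm (Finset.min'_le _ _ hk) (Finset.le_min' _ _ _ fun j hj => ?_)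
    by_contra! hjk
    exact Finsupp.mem_support_iff.1 hj (h.1 j hjk)
  rw [chiQ, dif_pos hne, hmin]

theorem isPdg_chiQ : IsPdg chiQ cQ := isPdg_lex chiQ_zero fun _ _ => chiQ_of_isLead

theorem countable_qSum : Countable QSum := inferInstanceAs (Countable (ℕ →₀ ℚ))

theorem model_qSum : QSum ⊨ T := (model_struct_iff chiQ cQ).2 isPdg_chiQ

variable {Γ : Type*} [AddCommGroup Γ] [LinearOrder Γ] [IsOrderedAddMonoid Γ]
  {χ : Γ → Γ} {c : Γ}

/-- The ultrametric inequality: `|x + y|` is at most twice the larger of `|x|` and `|y|`, and `χ`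
ignores the factor `2`. -/
theorem IsPdg.abs_chi_add_le (h : IsPdg χ c) {x y g : Γ} (hx : |χ x| ≤ g) (hy : |χ y| ≤ g) :
    |χ (x + y)| ≤ g := by
  rw [← h.chi_abs] at *
  rcases le_total |x| |y| with hxy | hxy
  · refine (h.monotone _ (2 • |y|) ?_).trans ((h.chi_nsmul two_ne_zero _).trans_le hy)
    rw [two_nsmul]
    exact (abs_add_le x y).trans (by gcongr)
  · refine (h.monotone _ (2 • |x|) ?_).trans ((h.chi_nsmul two_ne_zero _).trans_le hx)
    rw [two_nsmul]
    exact (abs_add_le x y).trans (by gcongr)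

/-- The rational model embeds into every model. -/
theorem IsPdg.exists_isPdgEmbedding_qSum (h : IsPdg χ c) :
    ∃ f : QSum → Γ, IsPdgEmbedding chiQ cQ χ c f := by
  let _ : Module ℚ Γ := ratModule h.divisible
  -- The first basis element may go to `-w₀` for any `w₀ < 0` with `χ w₀ = c`; the images of the
  -- others are then forced by `χ`.
  obtain ⟨w₀, hw₀, hwc⟩ := h.c_mem
  have hw₀' : w₀ < 0 := hw₀
  let e : ℕ → Γ := fun n => -χ^[n] w₀
  have he_succ : ∀ n, χ (e n) = e (n + 1) := fun n => by
    simp only [e, h.map_neg, Function.iterate_succ_apply']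
  have he_pos : ∀ n, 0 < e n := by
    intro n
    induction n with
    | zero => exact neg_pos.2 hw₀'
    | succ n ih => rw [← he_succ]; exact h.chi_pos_iff.2 ih
  have he_anti : StrictAnti e := strictAnti_nat_of_succ_lt fun n => by
    have := h.lt_chi (neg_lt_zero.2 (he_pos n))
    rwa [h.map_neg, he_succ, neg_lt_neg_iff] at this
  let F : (ℕ →₀ ℚ) →ₗ[ℚ] Γ := Finsupp.linearCombination ℚ e
  have hFs : ∀ n q, F (Finsupp.single n q) = q • e n := fun n q =>
    Finsupp.linearCombination_single ℚ q n
  -- Terms beyond index `k` contract to at most `e (k + 2)`, so they cannot affect the leading value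
  -- `e (k + 1)`.
  have hsmall : ∀ (r : ℕ →₀ ℚ) (k : ℕ), (∀ j ≤ k, r j = 0) → |χ (F r)| < e (k + 1) := by
    intro r k hr
    refine lt_of_le_of_lt ?_ (he_anti (k + 1).lt_succ_self)
    change |χ (r.sum fun n q => q • e n)| ≤ _
    refine Finset.sum_induction _ (fun x => |χ x| ≤ e (k + 2))
      (fun x y hx hy => h.abs_chi_add_le hx hy) ?_ ?_
    · rw [h.chi_zero, abs_zero]
      exact (he_pos _).le
    · intro n hn
      have hkn : k < n := by
        by_contra! hnk
        exact Finsupp.mem_support_iff.1 hn (hr n hnk)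
      have : |χ (r n • e n)| = e (n + 1) := by
        rcases (Finsupp.mem_support_iff.1 hn).lt_or_gt with hlt | hgt
        · rw [h.chi_smul_of_neg hlt, abs_neg, he_succ, abs_of_pos (he_pos _)]
        · rw [h.chi_smul_of_pos hgt, he_succ, abs_of_pos (he_pos _)]
      rw [this]
      exact he_anti.antitone (by omega)
  have hlead : ∀ (a : QSum) k, IsLead a k →
      χ (F (ofLex a)) = ((SignType.sign (ofLex a k) : SignType) : ℚ) • e (k + 1) := by
    intro a k ha
    have hsplit : ofLex a = Finsupp.single k (ofLex a k) + (ofLex a).erase k :=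
      (Finsupp.single_add_erase k (ofLex a)).symm
    have hr : |χ (F ((ofLex a).erase k))| < e (k + 1) := hsmall _ k fun j hj => by
      rcases hj.lt_or_eq with hj | rfl
      · rw [Finsupp.erase_ne hj.ne, ha.1 j hj]
      · exact Finsupp.erase_same
    rw [hsplit, map_add, hFs, ← hsplit]
    rcases ha.2.lt_or_gt with hlt | hgt
    · have h1 : χ (ofLex a k • e k) = -e (k + 1) := by rw [h.chi_smul_of_neg hlt, he_succ]
      rw [h.chi_add_of_abs_lt (by rwa [h1, abs_neg, abs_of_pos (he_pos _)]), h1, sign_neg hlt]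
      simp
    · have h1 : χ (ofLex a k • e k) = e (k + 1) := by rw [h.chi_smul_of_pos hgt, he_succ]
      rw [h.chi_add_of_abs_lt (by rwa [h1, abs_of_pos (he_pos _)]), h1, sign_pos hgt]
      simp
  refine ⟨fun a => F (ofLex a), fun a b => F.map_add _ _, fun a b hab => ?_, fun a => ?_, ?_⟩
  -- The sign of `F` on a difference is read off from its contraction.
  · obtain ⟨k, hk⟩ := exists_isLead (sub_pos.2 hab).ne'
    have := hlead _ k hk
    rw [sign_pos (hk.pos_iff.1 (sub_pos.2 hab))] at this
    have h1 : 0 < F (ofLex (b - a)) := by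
      rw [← h.chi_pos_iff, this]
      simpa using he_pos (k + 1)
    rwa [ofLex_sub, map_sub, sub_pos] at h1
  · by_cases ha : a = 0
    · rw [ha, chiQ_zero]
      change F 0 = χ (F 0)
      rw [map_zero, h.chi_zero]
    · obtain ⟨k, hk⟩ := exists_isLead ha
      rw [chiQ_of_isLead hk, hlead a k hk, ofLex_toLex, hFs]
  · change F (Finsupp.single 1 (-1)) = c
    rw [hFs, neg_smul, one_smul, ← hwc]
    exact neg_neg _

theorem nonempty_embedding_qSum (M : Type*) [L.Structure M] (hM : M ⊨ T) :
    Nonempty (QSum ↪[L] M) := by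
  obtain ⟨_, _, _, χ, c, hS⟩ := exists_eq_struct M hM
  have h : IsPdg χ c := (model_struct_iff χ c).1 (hS ▸ hM)
  obtain ⟨f, hf⟩ := h.exists_isPdgEmbedding_qSum
  exact nonempty_embedding_of_isPdgEmbedding rfl hS hf

end Rational

/-! # The value group of logarithmic transseries -/

section Logarithmic

/-- The support consists of the points `-unit ℝ (i + 1)` with `i` in the support of `γ`. These
increase with `i`, so the leading index gives the least one. -/
theorem orderTop_logMonomial {γ : GammaLog} {k : ℕ} (hk : IsLead γ k) :
    (logMonomial γ).orderTop = ((-unit ℝ (k + 1) : GammaLog) : WithTop GammaLog) := by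
  have hcoeff : ∀ δ : GammaLog, (logMonomial γ).coeff δ =
      ∑ i ∈ (-ofLex γ).support, (-ofLex γ) i * if δ = -unit ℝ (i + 1) then 1 else 0 := by
    intro δ
    rw [logMonomial, Finsupp.sum, HahnSeries.coeff_sum]
    refine Finset.sum_congr rfl fun i _ => ?_
    rw [HahnSeries.coeff_smul, monomial, HahnSeries.coeff_single, smul_eq_mul]
    congr
  apply le_antisymm
  · refine HahnSeries.orderTop_le_of_coeff_ne_zero ?_
    rw [hcoeff, Finset.sum_eq_single k]
    · simpa using hk.2
    · intro i _ hi
      rw [if_neg, mul_zero]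
      intro h
      exact hi (Nat.succ_injective (unit_strictAnti.injective (neg_injective h))).symm
    · intro h
      rw [Finsupp.notMem_support_iff.1 h, zero_mul]
  · rw [HahnSeries.le_orderTop_iff_forall]
    intro δ hδ
    rw [hcoeff]
    refine Finset.sum_eq_zero fun i hi => ?_
    rw [if_neg, mul_zero]
    rintro rfl
    have hik : i + 1 < k + 1 := unit_strictAnti.lt_iff_gt.1
      (neg_lt_neg_iff.1 (WithTop.coe_lt_coe.1 hδ))
    rw [Finsupp.mem_support_iff, Finsupp.neg_apply, hk.1 i (Nat.lt_of_succ_lt_succ hik)] at hi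
    simp at hi

/-- By `v_log`, only the logarithm of the dominant monomial contributes to the valuation. -/
theorem chiNeg_of_isLead {γ : GammaLog} {k : ℕ} (hk : IsLead γ k) (hγ : γ < 0) :
    chiNeg γ = -unit ℝ (k + 1) := by
  have h := v_log (f := monomialOf γ) (by simp [Pos, monomialOf]) (by simp [v, monomialOf]) hγ
  rw [orderTop_logMonomial hk] at h
  have hne : (log (monomialOf γ)).1 ≠ 0 := by
    rw [← HahnSeries.orderTop_ne_top]
    exact ne_top_of_lt (h.1.trans_lt h.2)
  exact WithTop.coe_injective ((HahnSeries.order_eq_orderTop_of_ne_zero hne).trans h.1)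

theorem chiLog_zero : chiLog 0 = 0 := by
  rw [chiLog, if_neg (lt_irrefl _), if_pos rfl]

theorem chiLog_of_isLead {a : GammaLog} {k : ℕ} (h : IsLead a k) :
    chiLog a = toLex (Finsupp.single (k + 1) ((SignType.sign (ofLex a k) : SignType) : ℝ)) := by
  rw [chiLog]
  split_ifs with h1 h2
  · rw [chiNeg_of_isLead h h1, sign_neg (h.neg_iff.1 h1), unit]
    simp
  · exact absurd h2 h.ne_zero
  · have hpos : 0 < a := (not_lt.1 h1).lt_of_ne (Ne.symm h2)
    rw [chiNeg_of_isLead h.neg (neg_lt_zero.2 hpos), sign_pos (h.pos_iff.1 hpos), unit]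
    simp

theorem model_gammaLog : GammaLog ⊨ T :=
  (model_struct_iff chiLog cLog).2 (isPdg_lex chiLog_zero fun _ _ => chiLog_of_isLead)

end Logarithmic

/-! # The main theorem -/

section Main

open FirstOrder.Language

theorem isPrimeModel_qSum : IsPrimeModel.{u} T QSum := by
  have : Countable QSum := countable_qSum
  refine ⟨model_qSum, fun N _ hN => ?_⟩
  obtain ⟨f⟩ := nonempty_embedding_qSum N hN
  exact ⟨⟨f, fun n φ x =>
    realize_iff_of_countable hN model_qSum model_qSum f (Embedding.refl L QSum) φ x⟩⟩

/-- Any two models contain copies of the countable model `QSum`, over which they satisfy the same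
sentences. -/
theorem isComplete : T.IsComplete := by
  rw [Theory.IsComplete.isComplete_iff_models_elementarily_equivalent]
  have := model_qSum
  have : Countable QSum := countable_qSum
  refine ⟨Theory.Model.isSatisfiable QSum, fun M N => ?_⟩
  rw [elementarilyEquivalent_iff]
  intro φ
  obtain ⟨f⟩ := nonempty_embedding_qSum M M.is_model
  obtain ⟨g⟩ := nonempty_embedding_qSum N N.is_model
  have h := realize_iff_of_countable M.is_model N.is_model model_qSum f g φ default
  rwa [Subsingleton.elim (f ∘ default) default, Subsingleton.elim (g ∘ default) default] at h

end Main

end Pdg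

/-- The model `(⨁ ℚ eᵢ, χ_ℚ)` of the theory `T` embeds into every model of `T` and is a prime
model of `T`; the theory `T` is model complete and complete; and it is (up to logical consequence)
the complete theory of its model `(Γ_log, χ)`. -/
theorem mainTheorem2 :
    Pdg.QSum ⊨ Pdg.T ∧
    (∀ (M : Type u) [Pdg.L.Structure M], M ⊨ Pdg.T → Nonempty (Pdg.QSum ↪[Pdg.L] M)) ∧
    Pdg.IsPrimeModel.{u} Pdg.T Pdg.QSum ∧
    Pdg.IsModelComplete.{u} Pdg.T ∧
    Pdg.T.IsComplete ∧
    Pdg.GammaLog ⊨ Pdg.T ∧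
    (∀ φ : Pdg.L.Sentence, φ ∈ Pdg.L.completeTheory Pdg.GammaLog ↔ Pdg.T ⊨ᵇ φ) := by
  have := Pdg.model_gammaLog
  exact ⟨Pdg.model_qSum, fun M _ hM => Pdg.nonempty_embedding_qSum M hM, Pdg.isPrimeModel_qSum,
    Pdg.isModelComplete, Pdg.isComplete, Pdg.model_gammaLog,
    fun φ => Pdg.isComplete.realize_sentence_iff φ Pdg.GammaLog⟩
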